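/- Let $n,m\ge 0$, let $\Omega\subseteq\mathbb R^n$ be non-empty, open and convex, and let $T_\Omega=\mathbb R^n+i\Omega\subset\mathbb C^n$. Write $\Omega'\Subset\Omega$ if $\overline{\Omega'}$ is compact and contained in $\Omega$, and $\langle z,\lambda\rangle=\sum_j z_j\lambda_j$ for $z\in\mathbb C^n$, $\lambda\in\mathbb R^n$. A holomorphic mapping $F=(f_1,\dots,f_m):T_\Omega\to\mathbb C^m$ is almost periodic if for all $\varepsilon>0$ and $\Omega'\Subset\Omega$ there are $t_1,\dots,t_n>0$ such that for each $\xi\in\mathbb R^n$ some $\tau\in\mathbb R^n$ with $|\tau_j-\xi_j|<t_j$ for all $j$ satisfies $|f_\ell(z+\tau)-f_\ell(z)|<\varepsilon$ for all $z\in T_{\Omega'}$ and all $\ell$. Let $HAP(T_\Omega,\mathbb C^m)$ be the space of these mappings, with the topology $\tau(T_\Omega)$ of uniform convergence on every subtube $T_{\Omega'}$, $\Omega'\Subset\Omega$. For $F\in HAP(T_\Omega,\mathbb C^m)$ and $\lambda\in\mathbb R^n$ put $$a(\lambda,f_\ell)=\lim_{s\to+\infty}\frac1{(2s)^n}\int_{|x_j|<s,\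 j=1,\dots,n}e^{-i\langle x+iy,\lambda\rangle}f_\ell(x+iy)\,dx$$ (the limit is the same for every $y\in\Omega$), $\operatorname{Sp}f_\ell=\{\lambda: a(\lambda,f_\ell)\ne0\}$, and let $\Xi_F$ be the additive subgroup of $\mathbb R^n$ generated by $\bigcup_\ell\operatorname{Sp}f_\ell$, and $\operatorname{lin}_{\mathbb Q}\Xi_F$ its $\mathbb Q$-linear span. Given a finite or infinite sequence $(\omega_r)_{r\ge1}$ that is a basis of $\operatorname{lin}_{\mathbb Q}\Xi_F$, let $Q_j(F)$ be the mapping with components $$Q_j(f_\ell)(z)=\sum_{\nu}\ \prod_{r}\Bigl(1-\frac{|\nu_r|}{(j!)^2}\Bigr)\,a\Bigl(\sum_r\nu_r\frac{\omega_r}{j!},f_\ell\Bigr)\,e^{i\sum_r\nu_r\langle z,\omega_r/j!\rangle},$$ where $r$ runs over the indices $\le j$ in the sequence and $\nu=(\nu_r)_r$ over the tuples of integers with $|\nu_r|\le(j!)^2$. Let $\operatorname{Ch}\mathbb R^n=\operatorname{Hom}_{\mathbb Z}(\mathbb R^n,\mathbb S^1)$ be the group of all (not necessarily continuous) characters, with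 the topology of pointwise convergence. An exponential sum is a finite (possibly empty) $\mathbb C$-linear combination of functions $e^{i\langle z,\lambda\rangle}$, $\lambda\in\mathbb R^n$. For a mapping $P=(p_1,\dots,p_m)$ whose components are exponential sums and for $\chi\in\operatorname{Ch}\mathbb R^n$, let $P_\chi$ have the components $\sum_{\lambda\in\operatorname{Sp}p_\ell}a(\lambda,p_\ell)\chi(\lambda)e^{i\langle z,\lambda\rangle}$. Let $F\in HAP(T_\Omega,\mathbb C^m)$. Then $\operatorname{lin}_{\mathbb Q}\Xi_F$ has a basis that is a finite or infinite sequence, and for every $\chi\in\operatorname{Ch}\mathbb R^n$ the limit $$F_\chi=\lim_{j\to+\infty}Q_j(F)_\chi$$ exists in $HAP(T_\Omega,\mathbb C^m)$ with the topology $\tau(T_\Omega)$ for every such basis, and does not depend on the basis; if the components of $F$ are exponential sums, then $F_\chi$ is the mapping defined above for such sums. Moreover $\operatorname{Ch}\mathbb R^n$ is compact, and the map $$\operatorname{Ch}\mathbb R^n\to HAP(T_\Omega,\mathbb C^m),\qquad \chi\mapsto F_\chi,$$ is continuous. In particular, if a sequence $(\chi_r)$ converges to $\chi$ in $\operatorname{Ch}\mathbb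 R^n$, then $(F_{\chi_r})$ converges to $F_\chi$ in the topology $\tau(T_\Omega)$. -/

import Mathlib

open Filter Topology MeasureTheory

noncomputable section

namespace AlmostPeriodic

/-- The horizontal tube `T_Ω = ℝⁿ + iΩ` in `ℂⁿ`. -/
def tube {n : ℕ} (Ω : Set (Fin n → ℝ)) : Set (Fin n → ℂ) :=
  {z | (fun j => (z j).im) ∈ Ω}

/-- The point `x + iy` of `T_Ω`, for `x ∈ ℝⁿ` and `y ∈ Ω`. -/
def tubePoint {n : ℕ} {Ω : Set (Fin n → ℝ)} (x : Fin n → ℝ) (y : Ω) : tube Ω :=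
  ⟨fun j => (x j : ℂ) + (y.1 j : ℂ) * Complex.I, by
    have h : (fun j => ((x j : ℂ) + (y.1 j : ℂ) * Complex.I).im) = y.1 := by
      funext j; simp
    show (fun j => ((x j : ℂ) + (y.1 j : ℂ) * Complex.I).im) ∈ Ω
    rw [h]; exact y.2⟩

/-- The real translate `z + t` of a point `z` of `T_Ω`, for `t ∈ ℝⁿ`. -/
def translate {n : ℕ} {Ω : Set (Fin n → ℝ)} (z : tube Ω) (t : Fin n → ℝ) : tube Ω :=
  ⟨fun j => z.1 j + (t j : ℂ), by
    have h : (fun j => (z.1 j + (t j : ℂ)).im) = fun j => (z.1 j).im := by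
      funext j; simp
    show (fun j => (z.1 j + (t j : ℂ)).im) ∈ Ω
    rw [h]; exact z.2⟩

/-- `Ω' ⋐ Ω`: the set `Ω'` is relatively compact in `Ω`. -/
def RelCompact {n : ℕ} (Ω' Ω : Set (Fin n → ℝ)) : Prop :=
  IsCompact (closure Ω') ∧ closure Ω' ⊆ Ω

/-- The subtube of `T_Ω` with base `Ω'`. -/
def subtube {n : ℕ} (Ω Ω' : Set (Fin n → ℝ)) : Set (tube Ω) :=
  {z | (fun j => (z.1 j).im) ∈ Ω'}

/-- Holomorphy of a mapping that is defined on the tube `T_Ω` only. -/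
def IsHolomorphic {n m : ℕ} {Ω : Set (Fin n → ℝ)} (F : tube Ω → Fin m → ℂ) : Prop :=
  ∃ G : (Fin n → ℂ) → Fin m → ℂ, DifferentiableOn ℂ G (tube Ω) ∧ ∀ z : tube Ω, F z = G z.1

/-- Almost periodicity in the tube `T_Ω`: for every `ε > 0` and `Ω' ⋐ Ω`, the `ε`-almost periods
of `F` on `T_Ω'` meet all translates of some open parallelotope. -/
def IsAlmostPeriodic {n m : ℕ} {Ω : Set (Fin n → ℝ)} (F : tube Ω → Fin m → ℂ) : Prop :=
  ∀ ε : ℝ, 0 < ε → ∀ Ω' : Set (Fin n → ℝ), RelCompact Ω' Ω →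
    ∃ t : Fin n → ℝ, (∀ l, 0 < t l) ∧ ∀ ξ : Fin n → ℝ, ∃ τ : Fin n → ℝ,
      (∀ l, |τ l - ξ l| < t l) ∧
      ∀ z ∈ subtube Ω Ω', ∀ l, ‖F (translate z τ) l - F z l‖ < ε

/-- The space `HAP(T_Ω, ℂᵐ)` of holomorphic almost periodic mappings. -/
structure HAP {n : ℕ} (Ω : Set (Fin n → ℝ)) (m : ℕ) where
  toFun : tube Ω → Fin m → ℂ
  holomorphic : IsHolomorphic toFun
  almostPeriodic : IsAlmostPeriodic toFun

/-- The topology `τ(T_Ω)` of uniform convergence on the subtubes with relatively compact base. -/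
instance {n : ℕ} (Ω : Set (Fin n → ℝ)) (m : ℕ) : TopologicalSpace (HAP Ω m) :=
  TopologicalSpace.induced
    (fun F => UniformOnFun.ofFun {S | ∃ Ω', RelCompact Ω' Ω ∧ S = subtube Ω Ω'} F.toFun)
    inferInstance

/-- The bilinear pairing `⟨z, lam⟩ = ∑ zⱼ lamⱼ`, for `z ∈ ℂⁿ` and `lam ∈ ℝⁿ`. -/
def pairing {n : ℕ} (z : Fin n → ℂ) (lam : Fin n → ℝ) : ℂ := ∑ j, z j * (lam j : ℂ)

/-- The exponential `e^{i⟨z, lam⟩}`. -/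
def expo {n : ℕ} (lam : Fin n → ℝ) (z : Fin n → ℂ) : ℂ :=
  Complex.exp (Complex.I * pairing z lam)

lemma expo_add {n : ℕ} (lam : Fin n → ℝ) (z w : Fin n → ℂ) :
    expo lam (fun j => z j + w j) = expo lam z * expo lam w := by
  unfold expo pairing
  rw [← Complex.exp_add, ← mul_add, ← Finset.sum_add_distrib]
  congr 2
  exact Finset.sum_congr rfl fun j _ => by ring

lemma norm_expo {n : ℕ} (lam : Fin n → ℝ) (z : Fin n → ℂ) :
    ‖expo lam z‖ = Real.exp (-∑ j, (z j).im * lam j) := by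
  unfold expo pairing
  rw [Complex.norm_exp]
  congr 1
  simp [Complex.mul_im]

/-- Finite sums of vector multiples of exponentials are holomorphic. -/
lemma isHolomorphic_expSum {n m : ℕ} (Ω : Set (Fin n → ℝ)) {ι : Type*} (s : Finset ι)
    (c : ι → Fin m → ℂ) (μ : ι → Fin n → ℝ) :
    IsHolomorphic (fun (z : tube Ω) l => ∑ i ∈ s, c i l * expo (μ i) z.1) := by
  refine ⟨fun z l => ∑ i ∈ s, c i l * expo (μ i) z, ?_, fun z => rfl⟩
  apply Differentiable.differentiableOn
  unfold expo pairing
  fun_prop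

/-- Finite sums of vector multiples of exponentials are almost periodic. -/
lemma isAlmostPeriodic_expSum {n m : ℕ} (Ω : Set (Fin n → ℝ)) {ι : Type*} (s : Finset ι)
    (c : ι → Fin m → ℂ) (μ : ι → Fin n → ℝ) :
    IsAlmostPeriodic (fun (z : tube Ω) l => ∑ i ∈ s, c i l * expo (μ i) z.1) := by
  intro ε hε Ω' hΩ'
  -- a bound for the terms on the subtube
  have hb : ∀ i l, ∃ M : ℝ, 0 ≤ M ∧ ∀ z ∈ subtube Ω Ω', ‖c i l * expo (μ i) z.1‖ ≤ M := by
    intro i l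
    have hcont : ContinuousOn (fun y : Fin n → ℝ => ‖c i l‖ * Real.exp (-∑ j, y j * μ i j))
        (closure Ω') := by fun_prop
    obtain ⟨M, hM⟩ := hΩ'.1.exists_bound_of_continuousOn hcont
    refine ⟨max M 0, le_max_right _ _, fun z hz => ?_⟩
    have h := hM _ (subset_closure hz)
    rw [norm_mul, norm_expo]
    exact (le_abs_self _).trans (h.trans (le_max_left _ _))
  choose M hM0 hM using hb
  set K : ℝ := (∑ l, ∑ i ∈ s, M i l) + 1 with hK
  have hKpos : 0 < K := by
    have : 0 ≤ ∑ l, ∑ i ∈ s, M i l :=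
      Finset.sum_nonneg fun l _ => Finset.sum_nonneg fun i _ => hM0 i l
    linarith
  have hKl : ∀ l, ∑ i ∈ s, M i l < K := by
    intro l
    have : ∑ i ∈ s, M i l ≤ ∑ l, ∑ i ∈ s, M i l :=
      Finset.single_le_sum (f := fun l => ∑ i ∈ s, M i l)
        (fun l _ => Finset.sum_nonneg fun i _ => hM0 i l) (Finset.mem_univ l)
    linarith
  -- finitely many translations suffice, by compactness of the torus
  let φ : (Fin n → ℝ) → (s → ℂ) := fun t i => expo (μ i) (fun j => (t j : ℂ))
  have hone : ∀ i (t : Fin n → ℝ), ‖expo (μ i) (fun j => (t j : ℂ))‖ = 1 := by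
    intro i t; rw [norm_expo]; simp
  have htb : TotallyBounded (Set.range φ) := by
    refine (isCompact_closedBall (0 : s → ℂ) 1).totallyBounded.subset ?_
    rintro _ ⟨t, rfl⟩
    rw [mem_closedBall_zero_iff, pi_norm_le_iff_of_nonneg zero_le_one]
    exact fun i => (hone i t).le
  have hδ : 0 < ε / K := div_pos hε hKpos
  obtain ⟨T, hTs, hTf, hT⟩ := totallyBounded_iff_subset.1 htb _ (Metric.dist_mem_uniformity hδ)
  obtain ⟨T', hT'f, rfl⟩ : ∃ T' : Set (Fin n → ℝ), T'.Finite ∧ φ '' T' = T := by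
    have hg : ∀ y : T, ∃ t, φ t = y := fun y => hTs y.2
    choose g hg using hg
    have := hTf.to_subtype
    refine ⟨Set.range g, Set.finite_range g, ?_⟩
    rw [← Set.range_comp, show φ ∘ g = Subtype.val from funext hg, Subtype.range_coe]
  obtain ⟨B, hBpos, hB⟩ := hT'f.isBounded.exists_pos_norm_le
  refine ⟨fun _ => B + 1, fun _ => by linarith, fun ξ => ?_⟩
  have := hT ⟨ξ, rfl⟩
  simp only [Set.mem_iUnion, Set.mem_image, exists_prop, Set.mem_ofPred_eq] at this
  obtain ⟨_, ⟨t, ht, rfl⟩, hdist⟩ := this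
  refine ⟨fun j => ξ j - t j, fun l => ?_, fun z hz l => ?_⟩
  · have h1 : |t l| ≤ ‖t‖ := norm_le_pi_norm t l
    have h2 := hB t ht
    rw [show ξ l - t l - ξ l = -t l by ring, abs_neg]
    linarith
  · have hterm : ∀ i ∈ s, ‖expo (μ i) (fun j => ((ξ j - t j : ℝ) : ℂ)) - 1‖ ≤ ε / K := by
      intro i hi
      have h1 : expo (μ i) (fun j => (ξ j : ℂ)) =
          expo (μ i) (fun j => ((ξ j - t j : ℝ) : ℂ)) * expo (μ i) (fun j => (t j : ℂ)) := by
        rw [← expo_add]; congr 1; funext j; push_cast; ring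
      have h2 : ‖expo (μ i) (fun j => (ξ j : ℂ)) - expo (μ i) (fun j => (t j : ℂ))‖ ≤ ε / K := by
        have := (dist_le_pi_dist (φ ξ) (φ t) ⟨i, hi⟩).trans (le_of_lt hdist)
        rwa [dist_eq_norm] at this
      have h3 : expo (μ i) (fun j => (ξ j : ℂ)) - expo (μ i) (fun j => (t j : ℂ)) =
          (expo (μ i) (fun j => ((ξ j - t j : ℝ) : ℂ)) - 1) * expo (μ i) (fun j => (t j : ℂ)) := by
        rw [h1]; ring
      rwa [h3, norm_mul, hone, mul_one] at h2
    simp only [translate]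
    rw [← Finset.sum_sub_distrib]
    calc ‖∑ i ∈ s, (c i l * expo (μ i) (fun j => z.1 j + ((ξ j - t j : ℝ) : ℂ)) -
            c i l * expo (μ i) z.1)‖
        ≤ ∑ i ∈ s, M i l * (ε / K) := by
          refine norm_sum_le_of_le _ fun i hi => ?_
          rw [expo_add, show c i l * (expo (μ i) z.1 *
              expo (μ i) (fun j => ((ξ j - t j : ℝ) : ℂ))) - c i l * expo (μ i) z.1 =
            (c i l * expo (μ i) z.1) *
              (expo (μ i) (fun j => ((ξ j - t j : ℝ) : ℂ)) - 1) by ring, norm_mul]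
          exact mul_le_mul (hM i l z hz) (hterm i hi) (norm_nonneg _) (hM0 i l)
      _ = (∑ i ∈ s, M i l) * (ε / K) := by rw [Finset.sum_mul]
      _ < K * (ε / K) := mul_lt_mul_of_pos_right (hKl l) hδ
      _ = ε := by field_simp

/-- The mapping `z ↦ ∑ᵢ cᵢ e^{i⟨z, μᵢ⟩}`, a finite sum with coefficients `cᵢ ∈ ℂᵐ`. -/
def expSum {n m : ℕ} (Ω : Set (Fin n → ℝ)) {ι : Type*} (s : Finset ι)
    (c : ι → Fin m → ℂ) (μ : ι → Fin n → ℝ) : HAP Ω m where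
  toFun z l := ∑ i ∈ s, c i l * expo (μ i) z.1
  holomorphic := isHolomorphic_expSum Ω s c μ
  almostPeriodic := isAlmostPeriodic_expSum Ω s c μ

instance {n : ℕ} (Ω : Set (Fin n → ℝ)) (m : ℕ) : Nonempty (HAP Ω m) :=
  ⟨expSum Ω (∅ : Finset ℕ) (fun _ _ => 0) (fun _ _ => 0)⟩

/-- The elements of `Exp(T_Ω, ℂᵐ)`: mappings whose components are exponential sums. -/
def IsExp {n m : ℕ} {Ω : Set (Fin n → ℝ)} (F : HAP Ω m) : Prop :=
  ∃ (s : Finset (Fin n → ℝ)) (c : (Fin n → ℝ) → Fin m → ℂ),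
    ∀ z l, F.toFun z l = ∑ lam ∈ s, c lam l * expo lam z.1

/-- The Bohr transform `a(lam, f_l)` of the `l`-th component of `F`: the number which, for every
`y ∈ Ω`, is the limit as `s → +∞` of the means of `e^{-i⟨x+iy, lam⟩} f_l(x+iy)` over the cubes
`|x_j| < s`. -/
def bohr {n m : ℕ} {Ω : Set (Fin n → ℝ)} (F : HAP Ω m) (l : Fin m) (lam : Fin n → ℝ) : ℂ :=
  Classical.epsilon fun a : ℂ => ∀ y : Ω,
    Tendsto (fun s : ℝ => (1 / (2 * (s : ℂ)) ^ n) *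
      ∫ x in {x : Fin n → ℝ | ∀ j, |x j| < s},
        Complex.exp (-Complex.I * pairing (tubePoint x y).1 lam) * F.toFun (tubePoint x y) l)
      atTop (𝓝 a)

/-- The spectrum of the `l`-th component of `F`. -/
def spec {n m : ℕ} {Ω : Set (Fin n → ℝ)} (F : HAP Ω m) (l : Fin m) : Set (Fin n → ℝ) :=
  {lam | bohr F l lam ≠ 0}

/-- The `ℤ`-module `Ξ_F` of `F`. -/
def freqModule {n m : ℕ} {Ω : Set (Fin n → ℝ)} (F : HAP Ω m) : AddSubgroup (Fin n → ℝ) :=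
  AddSubgroup.closure (⋃ l, spec F l)

/-- The `ℚ`-module `lin_ℚ Ξ_F` of `F`. -/
def freqSpace {n m : ℕ} {Ω : Set (Fin n → ℝ)} (F : HAP Ω m) : Submodule ℚ (Fin n → ℝ) :=
  Submodule.span ℚ (freqModule F : Set (Fin n → ℝ))

/-- The sequence `ω₀, ω₁, …` with `d ≤ ∞` terms is a basis of the `ℚ`-vector space `V`. The values
`ω r` with `r ≥ d` are irrelevant. -/
def IsBasisSeq {n : ℕ} (V : Submodule ℚ (Fin n → ℝ)) (d : ℕ∞) (ω : ℕ → Fin n → ℝ) : Prop :=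
  LinearIndependent ℚ (fun r : {r : ℕ // (r : ℕ∞) < d} => ω r) ∧
    Submodule.span ℚ (ω '' {r : ℕ | (r : ℕ∞) < d}) = V

/-- The number of terms among the first `j` in a sequence with `d ≤ ∞` terms. -/
def numTerms (d : ℕ∞) (j : ℕ) : ℕ := (min (j : ℕ∞) d).toNat

/-- The frequency `∑ᵣ νᵣ (ωᵣ / j!)`. -/
def fejerFreq {n : ℕ} (ω : ℕ → Fin n → ℝ) (j : ℕ) {k : ℕ} (ν : Fin k → ℤ) : Fin n → ℝ :=
  ∑ r : Fin k, ((ν r : ℝ) / (j.factorial : ℝ)) • ω r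

/-- The multiplier `∏ᵣ (1 - |νᵣ| / (j!)²)`. -/
def fejerMult (j : ℕ) {k : ℕ} (ν : Fin k → ℤ) : ℝ :=
  ∏ r : Fin k, (1 - |(ν r : ℝ)| / ((j.factorial : ℝ)) ^ 2)

/-- The `j`-th Bochner-Fejér approximation `Q_j(F)` for the basis `ω₀, ω₁, …` with `d` terms. It
involves the first `j` basis vectors (all of them when there are fewer than `j`), and the tuples
of integers `νᵣ` with `|νᵣ| ≤ (j!)²`. -/
def bochnerFejer {n m : ℕ} {Ω : Set (Fin n → ℝ)} (d : ℕ∞) (ω : ℕ → Fin n → ℝ) (j : ℕ)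
    (F : HAP Ω m) : HAP Ω m :=
  expSum Ω
    (Fintype.piFinset fun _ : Fin (numTerms d j) =>
      Finset.Icc (-((j.factorial : ℤ) ^ 2)) ((j.factorial : ℤ) ^ 2))
    (fun ν l => (fejerMult j ν : ℂ) * bohr F l (fejerFreq ω j ν))
    (fun ν => fejerFreq ω j ν)

/-- The group `Ch ℝⁿ` of all homomorphisms from `ℝⁿ` to the circle, continuous or not. -/
abbrev Ch (n : ℕ) : Type := AddChar (Fin n → ℝ) Circle

/-- The weak topology of `Ch ℝⁿ`, that is, the topology of pointwise convergence. -/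
instance (n : ℕ) : TopologicalSpace (Ch n) :=
  TopologicalSpace.induced (fun χ (lam : Fin n → ℝ) => χ lam) inferInstance

open Classical in
/-- The perturbation by `χ` of an exponential sum `F`, with components
`∑ a(lam, f_l) χ(lam) e^{i⟨z, lam⟩}` over `lam` in the spectrum of `f_l`. The sum may run over the
union of the spectra of all components, since the coefficients vanish outside the spectrum. The
union is finite for exponential sums, and the value for other mappings is irrelevant. -/
def perturbExp {n m : ℕ} {Ω : Set (Fin n → ℝ)} (χ : Ch n) (F : HAP Ω m) : HAP Ω m :=
  if h : (⋃ l, spec F l).Finite then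
    expSum Ω h.toFinset (fun lam l => bohr F l lam * (χ lam : ℂ)) (fun lam => lam)
  else F

/-- The perturbation `F_χ`: the limit in `τ(T_Ω)` of the perturbed Bochner-Fejér approximations
`Q_j(F)_χ`, for some choice of a basis of `lin_ℚ Ξ_F`. -/
def perturb {n m : ℕ} {Ω : Set (Fin n → ℝ)} (χ : Ch n) (F : HAP Ω m) : HAP Ω m :=
  Classical.epsilon fun G : HAP Ω m => ∃ (d : ℕ∞) (ω : ℕ → Fin n → ℝ),
    IsBasisSeq (freqSpace F) d ω ∧
      Tendsto (fun j => perturbExp χ (bochnerFejer d ω j F)) atTop (𝓝 G)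

end AlmostPeriodic

end

/-! For an exponential sum `p`, evaluation at an arbitrary character is bounded by the supremum over
the continuous characters `e^{i⟨t, ·⟩}` (`norm_evalCh_le`). Indeed the coefficients of `p ^ k` are
means, hence at most `M ^ k`, and the number of its frequencies grows only polynomially in `k`, so
taking `k`-th roots removes the loss. Translating a point of a tube by `t ∈ ℝⁿ` amounts to applying
such a continuous character. So `P ↦ P_χ` is a contraction for the supremum over every subtube, with
the same constant for all `χ` (`norm_perturbExp_sub_le`).

Given this, everything follows from `Q_j(F) → F` uniformly on subtubes (`eventually_bochnerFejer`).
The sequences `Q_j(F)_χ` are then Cauchy, those of two bases approach each other, and the space is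
complete (`exists_tendsto_hap`). All estimates are uniform in `χ`, and `χ ↦ Q_j(F)_χ` involves only
finitely many values `χ(λ)`, so the limit is continuous in `χ`. Compactness of `Ch ℝⁿ` is
Tychonoff's theorem.

The convergence `Q_j(F) → F` rests on uniform approximation by exponential sums (`exists_isApprox`).
By Bogolyubov's lemma, first in finite groups, then in `ℤⁿ` and `ℝⁿ`, the almost periods contain a
Bohr set (`exists_bohr_set`). Thus `t ↦ F(z + t)` is nearly constant on the traces on `ℝⁿ` of open
sets of the compact group `Ch ℝⁿ`. A partition of unity followed by Stone-Weierstrass then gives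
exponential sums in `t` with coefficients holomorphic in `z`. Means therefore exist, and are
multiples of `e^{i⟨z, λ⟩}` by holomorphy. The Fejér kernels are non-negative with mean 1, so the
Bochner-Fejér means are contractions, and it suffices that they converge on single exponentials
(`tendsto_fejerWeight`). -/

open Filter Topology MeasureTheory

noncomputable section

namespace AlmostPeriodic

/-! ### Bogolyubov's lemma in finite abelian groups -/

section Bogolyubov

open Finset

variable {G : Type*} [AddCommGroup G] [Fintype G]

/-- The sum of the values of a character over a finite set. -/
def charSum (A : Finset G) (γ : AddChar G ℂ) : ℂ := ∑ a ∈ A, γ a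

lemma conj_charSum (A : Finset G) (γ : AddChar G ℂ) :
    (starRingEnd ℂ) (charSum A γ) = ∑ a ∈ A, γ (-a) := by
  simp only [charSum, map_sum, AddChar.map_neg_eq_conj]

lemma normSq_charSum (A : Finset G) (γ : AddChar G ℂ) :
    ((Complex.normSq (charSum A γ) : ℝ) : ℂ) = ∑ a ∈ A, ∑ b ∈ A, γ (a - b) := by
  rw [Complex.normSq_eq_conj_mul_self, mul_comm, conj_charSum, charSum, Finset.sum_mul_sum]
  simp only [sub_eq_add_neg, AddChar.map_add_eq_mul]

/-- Parseval's identity: by orthogonality of characters only the diagonal pairs `a = b` survive the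
sum over `γ`. -/
lemma sum_normSq_charSum (A : Finset G) :
    ∑ γ : AddChar G ℂ, Complex.normSq (charSum A γ) = Fintype.card G * #A := by
  classical
  have h : ((∑ γ : AddChar G ℂ, Complex.normSq (charSum A γ) : ℝ) : ℂ) =
      Fintype.card G * #A := by
    push_cast
    simp only [normSq_charSum]
    rw [Finset.sum_comm]
    have : ∀ a ∈ A, ∑ γ : AddChar G ℂ, ∑ b ∈ A, γ (a - b) = Fintype.card G := by
      intro a ha
      rw [Finset.sum_comm]
      simp only [AddChar.sum_apply_eq_ite, sub_eq_zero]
      simp [ha]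
    rw [Finset.sum_congr rfl this]
    simp [mul_comm]
  exact_mod_cast h

/-- Fourier inversion: the fourth power of the modulus of `charSum A` is the transform of the number
of representations `a + b - c - d`, and this number is zero at `x`. -/
lemma sum_normSq_sq_charSum_eq_zero (A : Finset G) (x : G)
    (hx : ∀ a ∈ A, ∀ b ∈ A, ∀ c ∈ A, ∀ d ∈ A, x ≠ a + b - c - d) :
    ∑ γ : AddChar G ℂ, Complex.normSq (charSum A γ) ^ 2 * (γ x).re = 0 := by
  classical
  have h : ∑ γ : AddChar G ℂ, ((Complex.normSq (charSum A γ) : ℝ) : ℂ) ^ 2 * γ (-x) = 0 := by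
    have : ∀ γ : AddChar G ℂ, ((Complex.normSq (charSum A γ) : ℝ) : ℂ) ^ 2 * γ (-x) =
        ∑ a ∈ A, ∑ c ∈ A, ∑ b ∈ A, ∑ d ∈ A, γ (a + b - c - d - x) := by
      intro γ
      rw [normSq_charSum, sq]
      simp only [Finset.sum_mul, Finset.mul_sum]
      refine Finset.sum_congr rfl fun a _ => Finset.sum_congr rfl fun c _ =>
        Finset.sum_congr rfl fun b _ => Finset.sum_congr rfl fun d _ => ?_
      rw [← AddChar.map_add_eq_mul, ← AddChar.map_add_eq_mul]
      congr 1
      abel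
    simp only [this]
    rw [Finset.sum_comm]
    refine Finset.sum_eq_zero fun a ha => ?_
    rw [Finset.sum_comm]
    refine Finset.sum_eq_zero fun c hc => ?_
    rw [Finset.sum_comm]
    refine Finset.sum_eq_zero fun b hb => ?_
    rw [Finset.sum_comm]
    refine Finset.sum_eq_zero fun d hd => ?_
    rw [AddChar.sum_apply_eq_ite, if_neg]
    exact fun h => hx a ha b hb c hc d hd (sub_eq_zero.1 h).symm
  have h2 := congrArg Complex.re h
  rw [Complex.re_sum, Complex.zero_re] at h2
  rw [← h2]
  refine Finset.sum_congr rfl fun γ _ => ?_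
  rw [← Complex.ofReal_pow, Complex.re_ofReal_mul, AddChar.map_neg_eq_conj, Complex.conj_re]

/-- Bogolyubov's lemma in a finite abelian group. -/
theorem exists_bohr_set_of_finite (A : Finset G) (D : ℕ) (hA : A.Nonempty)
    (hD : Fintype.card G ≤ D * #A) :
    ∃ Γ : Finset (AddChar G ℂ), #Γ ≤ 2 * D ^ 2 ∧ ∀ x, (∀ γ ∈ Γ, 0 ≤ (γ x).re) →
      ∃ a ∈ A, ∃ b ∈ A, ∃ c ∈ A, ∃ d ∈ A, x = a + b - c - d := by
  classical
  set α : ℝ := ((#A : ℕ) : ℝ) with hα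
  set g : ℝ := ((Fintype.card G : ℕ) : ℝ) with hg
  have hα0 : 0 < α := Nat.cast_pos.2 hA.card_pos
  have hg0 : 0 < g := Nat.cast_pos.2 Fintype.card_pos
  have hgD : g ≤ D * α := by rw [hg, hα]; exact_mod_cast hD
  -- The threshold of the large spectrum. Parseval bounds the number of characters above it by `2 g²
  -- / α² ≤ 2 D²`, while those below contribute at most `θ g α = α⁴ / 2`, half of the contribution
  -- `α⁴` of the trivial character.
  set θ : ℝ := α ^ 3 / (2 * g) with hθ
  have hθ0 : 0 < θ := by positivity
  refine ⟨univ.filter fun γ => θ ≤ Complex.normSq (charSum A γ), ?_, ?_⟩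
  · set Γ := univ.filter fun γ : AddChar G ℂ => θ ≤ Complex.normSq (charSum A γ)
    have h1 : #Γ * θ ≤ g * α := by
      rw [← sum_normSq_charSum A, ← nsmul_eq_mul]
      refine (Finset.card_nsmul_le_sum Γ _ θ fun γ hγ => (Finset.mem_filter.1 hγ).2).trans ?_
      exact Finset.sum_le_sum_of_subset_of_nonneg (Finset.subset_univ _)
        fun _ _ _ => Complex.normSq_nonneg _
    have h2 : (#Γ : ℝ) ≤ 2 * D ^ 2 := by
      have h3 : (#Γ : ℝ) * α ^ 2 ≤ 2 * g ^ 2 := by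
        rw [hθ, mul_div_assoc', div_le_iff₀ (by positivity)] at h1
        have : (#Γ : ℝ) * α ^ 2 * α ≤ 2 * g ^ 2 * α := by nlinarith
        exact le_of_mul_le_mul_right this hα0
      have h4 : g ^ 2 ≤ D ^ 2 * α ^ 2 := by
        rw [← mul_pow]; exact pow_le_pow_left₀ hg0.le hgD 2
      have : (#Γ : ℝ) * α ^ 2 ≤ 2 * D ^ 2 * α ^ 2 := by linarith
      exact le_of_mul_le_mul_right this (by positivity)
    exact_mod_cast h2
  · intro x hx
    by_contra! hne
    have h0 := sum_normSq_sq_charSum_eq_zero A x hne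
    -- Above the threshold the term is non-negative by the choice of `x`; below it, one factor of
    -- the square is less than `θ`.
    have hterm : ∀ γ ∈ (univ : Finset (AddChar G ℂ)).erase 0,
        -(θ * Complex.normSq (charSum A γ)) ≤ Complex.normSq (charSum A γ) ^ 2 * (γ x).re := by
      intro γ _
      have hn := Complex.normSq_nonneg (charSum A γ)
      by_cases hγ : θ ≤ Complex.normSq (charSum A γ)
      · have := hx γ (by simp [hγ])
        have h5 : 0 ≤ Complex.normSq (charSum A γ) ^ 2 * (γ x).re := by positivity
        have : 0 ≤ θ * Complex.normSq (charSum A γ) := by positivity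
        linarith
      · have h6 : -1 ≤ (γ x).re := by
          have := Complex.abs_re_le_norm (γ x)
          rw [AddChar.norm_apply] at this
          exact (abs_le.1 this).1
        push Not at hγ
        nlinarith
    rw [← Finset.add_sum_erase _ _ (Finset.mem_univ (0 : AddChar G ℂ))] at h0
    have h7 := Finset.sum_le_sum hterm
    rw [Finset.sum_neg_distrib, ← Finset.mul_sum] at h7
    have h8 : ∑ γ ∈ (univ : Finset (AddChar G ℂ)).erase 0, Complex.normSq (charSum A γ) ≤
        g * α := by
      rw [← sum_normSq_charSum A]
      exact Finset.sum_le_sum_of_subset_of_nonneg (Finset.subset_univ _)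
        fun _ _ _ => Complex.normSq_nonneg _
    have h9 : charSum A 0 = (α : ℂ) := by simp [charSum, hα]
    rw [h9, Complex.normSq_ofReal] at h0
    simp only [AddChar.zero_apply, Complex.one_re, mul_one] at h0
    have h10 : θ * (g * α) = α ^ 4 / 2 := by rw [hθ]; field_simp
    have h11 := mul_le_mul_of_nonneg_left h8 hθ0.le
    have : 0 < α ^ 4 := by positivity
    nlinarith

end Bogolyubov

/-! ### Bogolyubov's lemma in `ℤⁿ` -/

/-- Padding with a default element makes the index set independent of the finite group, so that
limits over `N` can be taken character by character. -/
lemma exists_fin_enum {α : Type*} [Nonempty α] (s : Finset α) (K : ℕ) (h : s.card ≤ K) :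
    ∃ f : Fin K → α, ∀ a ∈ s, ∃ k, f k = a := by
  classical
  refine ⟨fun k => if hk : (k : ℕ) < s.card then (s.equivFin.symm ⟨k, hk⟩ : α)
    else Classical.arbitrary α, fun a ha => ?_⟩
  refine ⟨⟨s.equivFin ⟨a, ha⟩, (s.equivFin ⟨a, ha⟩).2.trans_le h⟩, ?_⟩
  simp

/-- A bounded version of Bogolyubov's lemma in `ℤⁿ`. -/
lemma exists_bohr_set_int_aux {n : ℕ} (A : Set (Fin n → ℤ)) (L : ℕ) (hL : 0 < L)
    (hA : ∀ x : Fin n → ℤ, ∃ a ∈ A, ∀ j, x j ≤ a j ∧ a j < x j + L) (N : ℕ) (hN : 0 < N) :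
    ∃ ψ : Fin (2 * ((4 * L) ^ n) ^ 2) → AddChar (Fin n → ℤ) ℂ, (∀ k t, ‖ψ k t‖ = 1) ∧
      ∀ t : Fin n → ℤ, (∀ j, |t j| < N * L) → (∀ k, 0 ≤ (ψ k t).re) →
        ∃ a ∈ A, ∃ b ∈ A, ∃ c ∈ A, ∃ d ∈ A, t = a + b - c - d := by
  classical
  -- Combinations `a + b - c - d` of points of `[0, NL)ⁿ` differ from `t` by less than `3NL` in each
  -- coordinate, so congruence modulo `4NL` is equality.
  set q : ℕ := 4 * N * L with hq
  have hq0 : 0 < q := by positivity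
  have : NeZero q := ⟨hq0.ne'⟩
  choose p hpA hp using hA
  -- One point of `A` in each of `Nⁿ` disjoint cells of side `L`. The density in `(ℤ/q)ⁿ` is `1 /
  -- (4L)ⁿ`, which does not depend on `N`.
  let v : (Fin n → Fin N) → Fin n → ℤ := fun c => p fun j => (L : ℤ) * (c j : ℕ)
  have hv : ∀ c j, (L : ℤ) * (c j : ℕ) ≤ v c j ∧ v c j < L * (c j : ℕ) + L := fun c j => hp _ j
  have hL' : (0 : ℤ) < L := by exact_mod_cast hL
  have hv0 : ∀ c j, 0 ≤ v c j := fun c j => le_trans (by positivity) (hv c j).1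
  have hvN : ∀ c j, v c j < N * L := fun c j => by
    have h1 := (hv c j).2
    have h2 : ((c j : ℕ) : ℤ) + 1 ≤ N := by exact_mod_cast (c j).2
    nlinarith
  let π : (Fin n → ℤ) →+ (Fin n → ZMod q) :=
    { toFun := fun x j => (x j : ZMod q)
      map_zero' := by funext j; simp
      map_add' := fun x y => by funext j; simp }
  have hπ : ∀ x y : Fin n → ℤ, π x = π y → (∀ j, |x j - y j| < q) → x = y := by
    intro x y hxy hlt
    funext j
    have h1 : ((x j : ℤ) : ZMod q) = (y j : ZMod q) := congrFun hxy j
    rw [ZMod.intCast_eq_intCast_iff, Int.modEq_iff_dvd] at h1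
    have h2 := Int.eq_zero_of_abs_lt_dvd h1 (by rw [abs_sub_comm]; exact hlt j)
    linarith
  have hqc : (q : ℤ) = 4 * N * L := by rw [hq]; push_cast; ring
  have hNL : (0 : ℤ) < N * L := by positivity
  have hinj : Function.Injective fun c => π (v c) := by
    intro c c' hcc
    have h1 := hπ _ _ hcc fun j => by
      have := hv0 c j; have := hv0 c' j; have := hvN c j; have := hvN c' j
      rw [abs_lt]; constructor <;> nlinarith
    funext j
    have h2 := hv c j
    have h3 := hv c' j
    rw [h1] at h2
    have h4 : ((c j : ℕ) : ℤ) < (c' j : ℕ) + 1 := by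
      by_contra hcon; push Not at hcon; nlinarith [h2.1, h3.2]
    have h5 : ((c' j : ℕ) : ℤ) < (c j : ℕ) + 1 := by
      by_contra hcon; push Not at hcon; nlinarith [h2.2, h3.1]
    exact Fin.ext (by omega)
  obtain ⟨Γ, hΓ, hΓx⟩ := exists_bohr_set_of_finite
    (Finset.univ.image fun c => π (v c)) ((4 * L) ^ n)
    (by
      rw [Finset.image_nonempty]
      exact ⟨fun _ => ⟨0, hN⟩, Finset.mem_univ _⟩)
    (by
      rw [Finset.card_image_of_injective _ hinj]
      simp only [Fintype.card_pi, ZMod.card, Finset.prod_const, Finset.card_univ, Fintype.card_fin]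
      rw [← mul_pow, hq]
      exact le_of_eq (by ring))
  obtain ⟨f, hf⟩ := exists_fin_enum Γ _ hΓ
  refine ⟨fun k => (f k).compAddMonoidHom π, fun k t => ?_, fun t ht hre => ?_⟩
  · rw [AddChar.compAddMonoidHom_apply, AddChar.norm_apply]
  · obtain ⟨_, ha, _, hb, _, hc, _, hd, h⟩ := hΓx (π t) fun γ hγ => by
      obtain ⟨k, rfl⟩ := hf γ hγ
      exact hre k
    simp only [Finset.mem_image, Finset.mem_univ, true_and] at ha hb hc hd
    obtain ⟨a, rfl⟩ := ha
    obtain ⟨b, rfl⟩ := hb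
    obtain ⟨c, rfl⟩ := hc
    obtain ⟨d, rfl⟩ := hd
    refine ⟨v a, hpA _, v b, hpA _, v c, hpA _, v d, hpA _, hπ _ _ ?_ fun j => ?_⟩
    · rw [h]; simp only [map_add, map_sub]
    · have h1 := abs_lt.1 (ht j)
      have := hv0 a j; have := hv0 b j; have := hv0 c j; have := hv0 d j
      have := hvN a j; have := hvN b j; have := hvN c j; have := hvN d j
      simp only [Pi.add_apply, Pi.sub_apply]
      rw [abs_lt]; constructor <;> linarith [h1.1, h1.2]

/-- Bogolyubov's lemma in `ℤⁿ`. -/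
theorem exists_bohr_set_int {n : ℕ} (A : Set (Fin n → ℤ)) (L : ℕ) (hL : 0 < L)
    (hA : ∀ x : Fin n → ℤ, ∃ a ∈ A, ∀ j, x j ≤ a j ∧ a j < x j + L) :
    ∃ (K : ℕ) (ψ : Fin K → AddChar (Fin n → ℤ) ℂ), (∀ k t, ‖ψ k t‖ = 1) ∧
      ∀ t : Fin n → ℤ, (∀ k, 0 < (ψ k t).re) →
        ∃ a ∈ A, ∃ b ∈ A, ∃ c ∈ A, ∃ d ∈ A, t = a + b - c - d := by
  choose ψ hψ1 hψ using fun N : ℕ => exists_bohr_set_int_aux A L hL hA (N + 1) N.succ_pos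
  -- A free ultrafilter makes `ψ N k t` converge for all `k` and `t` at once; the limits are again
  -- characters.
  let U : Ultrafilter ℕ := hyperfilter ℕ
  have hU : (U : Filter ℕ) ≤ atTop := by
    rw [← Nat.cofinite_eq_atTop]; exact hyperfilter_le_cofinite
  have hlim : ∀ k t, ∃ w : ℂ, Tendsto (fun N => ψ N k t) U (𝓝 w) := by
    intro k t
    have h := (isCompact_closedBall (0 : ℂ) 1).ultrafilter_le_nhds
      (U.map fun N => ψ N k t) (by
        rw [Ultrafilter.coe_map, le_principal_iff, mem_map]
        exact univ_mem' fun N => by simp [hψ1])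
    obtain ⟨w, -, hw⟩ := h
    exact ⟨w, hw⟩
  choose u hu using hlim
  refine ⟨_, fun k => ⟨u k, ?_, fun s t => ?_⟩, fun k t => ?_, fun t ht => ?_⟩
  · refine tendsto_nhds_unique (hu k 0) ?_
    simp only [AddChar.map_zero_eq_one]
    exact tendsto_const_nhds
  · refine tendsto_nhds_unique (hu k (s + t)) ?_
    simp only [AddChar.map_add_eq_mul]
    exact (hu k s).mul (hu k t)
  · refine tendsto_nhds_unique (hu k t).norm ?_
    simp only [hψ1]
    exact tendsto_const_nhds
  -- The strict inequality assumed for the limit is what descends to `U`-almost all `N`.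
  · have h1 : ∀ᶠ N in (U : Filter ℕ), ∀ k, 0 ≤ (ψ N k t).re := by
      rw [eventually_all]
      intro k
      have := (Complex.continuous_re.tendsto _).comp (hu k t)
      exact (this.eventually_const_lt (ht k)).mono fun N h => h.le
    have h2 : ∀ᶠ N in (U : Filter ℕ), ∀ j, |t j| < ((N + 1 : ℕ) : ℤ) * L := by
      rw [eventually_all]
      intro j
      refine hU ?_
      filter_upwards [eventually_ge_atTop (t j).natAbs] with N hN
      have h3 : |t j| ≤ N := by rw [Int.abs_eq_natAbs]; exact_mod_cast hN
      have h4 : (1 : ℤ) ≤ L := by exact_mod_cast hL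
      push_cast
      nlinarith
    obtain ⟨N, h1, h2⟩ := (h1.and h2).exists
    exact hψ N t h2 h1

/-! ### Exponentials, and Bohr sets in `ℝⁿ` -/

lemma expo_ofReal {n : ℕ} (lam t : Fin n → ℝ) :
    expo lam (fun j => (t j : ℂ)) = Complex.exp (Complex.I * ((∑ j, t j * lam j : ℝ) : ℂ)) := by
  unfold expo pairing
  push_cast
  rfl

lemma norm_expo_ofReal {n : ℕ} (lam t : Fin n → ℝ) : ‖expo lam (fun j => (t j : ℂ))‖ = 1 := by
  rw [norm_expo]; simp

lemma expo_ofReal_add {n : ℕ} (lam s t : Fin n → ℝ) :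
    expo lam (fun j => ((s + t) j : ℂ)) =
      expo lam (fun j => (s j : ℂ)) * expo lam (fun j => (t j : ℂ)) := by
  rw [← expo_add]; congr 1; funext j; simp

lemma expo_add_freq {n : ℕ} (lam mu : Fin n → ℝ) (z : Fin n → ℂ) :
    expo (lam + mu) z = expo lam z * expo mu z := by
  unfold expo pairing
  rw [← Complex.exp_add, ← mul_add, ← Finset.sum_add_distrib]
  congr 2
  exact Finset.sum_congr rfl fun j _ => by simp; ring

lemma addChar_map_sum {ι A M : Type*} [AddCommMonoid A] [CommMonoid M] (ψ : AddChar A M)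
    (s : Finset ι) (f : ι → A) : ψ (∑ i ∈ s, f i) = ∏ i ∈ s, ψ (f i) := by
  classical
  induction s using Finset.induction_on with
  | empty => simp
  | insert i s hi ih => rw [Finset.sum_insert hi, Finset.prod_insert hi, AddChar.map_add_eq_mul, ih]

lemma addChar_int_apply {n : ℕ} (ψ : AddChar (Fin n → ℤ) ℂ) (t : Fin n → ℤ) :
    ψ t = ∏ j, ψ (Pi.single j 1) ^ t j := by
  conv_lhs => rw [← Finset.univ_sum_single t]
  rw [addChar_map_sum]
  refine Finset.prod_congr rfl fun j _ => ?_
  rw [← AddChar.map_zsmul_eq_zpow]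
  congr 1
  rw [← Pi.single_smul]
  simp

/-- A character of `ℤⁿ` of modulus one extends to a continuous character of `ℝⁿ` along the
embedding of `ℤⁿ` as the lattice `hℤⁿ`. -/
lemma exists_expo_eq_addChar {n : ℕ} (ψ : AddChar (Fin n → ℤ) ℂ) (hψ : ∀ t, ‖ψ t‖ = 1)
    (h : ℝ) (hh : h ≠ 0) :
    ∃ lam : Fin n → ℝ, (∀ j, |lam j| ≤ Real.pi / |h|) ∧
      ∀ t : Fin n → ℤ, expo lam (fun j => ((h * t j : ℝ) : ℂ)) = ψ t := by
  -- Principal arguments keep the frequencies at most `π / |h|`, so the exponential varies little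
  -- within a lattice cell.
  refine ⟨fun j => (ψ (Pi.single j 1)).arg / h, fun j => ?_, fun t => ?_⟩
  · rw [abs_div]
    exact div_le_div_of_nonneg_right (Complex.abs_arg_le_pi _) (abs_nonneg _)
  · rw [expo_ofReal, addChar_int_apply]
    push_cast
    rw [Finset.mul_sum, Complex.exp_sum]
    refine Finset.prod_congr rfl fun j _ => ?_
    conv_rhs => rw [← Complex.norm_mul_exp_arg_mul_I (ψ (Pi.single j 1)), hψ]
    rw [Complex.ofReal_one, one_mul, ← Complex.exp_int_mul]
    congr 1
    have : (h : ℂ) ≠ 0 := by exact_mod_cast hh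
    field_simp

/-- After reduction modulo 1 the right-hand side is `2 |sin (π v)|` with `|v| ≤ 1/2`, and Jordan's
inequality applies. It shows that `τ_j` is close to `hℤ` as soon as `e^{2πi τ_j / h}` is close to 1.
-/
lemma abs_sub_round_le_norm_exp_sub_one (u : ℝ) :
    4 * |u - round u| ≤ ‖Complex.exp (Complex.I * ((2 * Real.pi * u : ℝ) : ℂ)) - 1‖ := by
  set v := u - round u with hv
  have h1 : Complex.exp (Complex.I * ((2 * Real.pi * u : ℝ) : ℂ)) =
      Complex.exp (Complex.I * ((2 * Real.pi * v : ℝ) : ℂ)) := by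
    rw [Complex.exp_eq_exp_iff_exists_int]
    refine ⟨round u, ?_⟩
    rw [hv]; push_cast; ring
  rw [h1, Complex.norm_exp_I_mul_ofReal_sub_one, norm_mul, Real.norm_eq_abs, Real.norm_eq_abs]
  have hv2 : |v| ≤ 1 / 2 := abs_sub_round u
  have hpi := Real.pi_pos
  have h2 : |2 * Real.pi * v / 2| = Real.pi * |v| := by
    rw [show 2 * Real.pi * v / 2 = Real.pi * v by ring, abs_mul, abs_of_pos hpi]
  have h3 := Real.mul_abs_le_abs_sin (x := 2 * Real.pi * v / 2) (by rw [h2]; nlinarith)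
  rw [h2] at h3
  have h4 : 2 / Real.pi * (Real.pi * |v|) = 2 * |v| := by field_simp
  rw [h4] at h3
  rw [abs_two]
  linarith

/-- A relatively dense family of sets of almost periods, which contain neighbourhoods of `0`,
contains Bohr sets. -/
theorem exists_bohr_set_real {n : ℕ} (P : ℝ → Set (Fin n → ℝ))
    (hadd : ∀ ε δ a b, a ∈ P ε → b ∈ P δ → a + b ∈ P (ε + δ)) (hneg : ∀ ε a, a ∈ P ε → -a ∈ P ε)
    (ε : ℝ) (hzero : ∃ r : ℝ, 0 < r ∧ ∀ τ : Fin n → ℝ, (∀ j, |τ j| ≤ r) → τ ∈ P ε)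
    (hdense : ∃ T : ℝ, ∀ ξ : Fin n → ℝ, ∃ τ ∈ P ε, ∀ j, |τ j - ξ j| ≤ T) :
    ∃ (Λ : Finset (Fin n → ℝ)) (δ : ℝ), 0 < δ ∧ ∀ τ : Fin n → ℝ,
      (∀ lam ∈ Λ, ‖expo lam (fun j => (τ j : ℂ)) - 1‖ < δ) → τ ∈ P (9 * ε) := by
  classical
  obtain ⟨h, hh, hP⟩ := hzero
  obtain ⟨T, hT⟩ := hdense
  -- Rounding an `ε`-almost period down to the lattice `hℤⁿ` moves it by at most `h` per coordinate,
  -- at the cost of a second `ε`.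
  let A : Set (Fin n → ℤ) := {a | (fun j => h * a j) ∈ P (ε + ε)}
  obtain ⟨c, hc⟩ := exists_nat_ge (T / h)
  have hTc : T ≤ c * h := by rwa [div_le_iff₀ hh] at hc
  have hA : ∀ x : Fin n → ℤ, ∃ a ∈ A, ∀ j, x j ≤ a j ∧ a j < x j + ((2 * c + 3 : ℕ) : ℤ) := by
    intro x
    -- The shift by `c + 1` compensates for the error `T ≤ c h`, so that the rounded point does not
    -- fall below `x`.
    obtain ⟨τ, hτ, hτξ⟩ := hT fun j => h * (x j + c + 1)
    refine ⟨fun j => ⌊τ j / h⌋, ?_, fun j => ?_⟩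
    · have h1 : (fun j => h * (⌊τ j / h⌋ : ℝ) - τ j) ∈ P ε := by
        refine hP _ fun j => ?_
        have h2 := Int.floor_le (τ j / h)
        have h3 := Int.lt_floor_add_one (τ j / h)
        rw [le_div_iff₀ hh] at h2
        rw [div_lt_iff₀ hh] at h3
        rw [abs_le]; constructor <;> linarith
      have h2 := hadd _ _ _ _ hτ h1
      show (fun j => h * (⌊τ j / h⌋ : ℝ)) ∈ P (ε + ε)
      convert h2 using 1
      funext j; simp
    · have h1 := abs_le.1 (hτξ j)
      constructor
      · rw [Int.le_floor, le_div_iff₀ hh]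
        nlinarith
      · rw [Int.floor_lt, div_lt_iff₀ hh]
        push_cast
        nlinarith
  obtain ⟨K, ψ, hψ1, hψ⟩ := exists_bohr_set_int A (2 * c + 3) (by omega) hA
  choose lam hlam hlamψ using fun k => exists_expo_eq_addChar (ψ k) (hψ1 k) h hh.ne'
  -- The second family of frequencies forces `τ` near the lattice, the first controls the lattice
  -- characters at the nearest lattice point. With `δ = 1 / (1 + n)` the remainder changes these
  -- characters by at most `n / (1 + n)`, and both errors sum to less than 1, so the real parts are
  -- positive.
  refine ⟨Finset.univ.image lam ∪ Finset.univ.image fun j => Pi.single j (2 * Real.pi / h),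
    1 / (1 + n), by positivity, fun τ hτ => ?_⟩
  have hn : (0 : ℝ) < 1 + n := by positivity
  have hclose : ∀ j, |τ j - h * round (τ j / h)| ≤ h / (4 * (1 + n)) := by
    intro j
    have h1 := hτ (Pi.single j (2 * Real.pi / h)) (by simp)
    have h2 := abs_sub_round_le_norm_exp_sub_one (τ j / h)
    rw [expo_ofReal] at h1
    have h3 : ∑ i, τ i * (Pi.single j (2 * Real.pi / h) : Fin n → ℝ) i =
        2 * Real.pi * (τ j / h) := by
      rw [Finset.sum_eq_single j]
      · simp; ring
      · intro i _ hij; simp [hij]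
      · simp
    rw [h3] at h1
    have h4 : τ j - h * round (τ j / h) = h * (τ j / h - round (τ j / h)) := by field_simp
    rw [h4, abs_mul, abs_of_pos hh]
    have h5 : |τ j / h - round (τ j / h)| ≤ 1 / (1 + n) / 4 := by linarith
    calc h * |τ j / h - round (τ j / h)| ≤ h * (1 / (1 + n) / 4) :=
          mul_le_mul_of_nonneg_left h5 hh.le
      _ = h / (4 * (1 + n)) := by field_simp
  have hre : ∀ k, 0 < (ψ k fun j => round (τ j / h)).re := by
    intro k
    have h1 := hτ (lam k) (by simp)
    rw [← hlamψ k]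
    set w := expo (lam k) (fun j => ((h * round (τ j / h) : ℝ) : ℂ)) with hw
    set d : Fin n → ℝ := fun j => τ j - h * round (τ j / h) with hd
    have h2 : expo (lam k) (fun j => (τ j : ℂ)) = w * expo (lam k) (fun j => (d j : ℂ)) := by
      rw [hw, ← expo_add]; congr 1; funext j; simp [hd]
    have h3 : ‖expo (lam k) (fun j => (d j : ℂ)) - 1‖ ≤ n / (1 + n) := by
      rw [expo_ofReal]
      refine (Real.norm_exp_I_mul_ofReal_sub_one_le).trans ?_
      rw [Real.norm_eq_abs]
      calc |∑ j, d j * lam k j| ≤ ∑ j, |d j * lam k j| := Finset.abs_sum_le_sum_abs _ _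
        _ ≤ ∑ j : Fin n, 1 / (1 + (n : ℝ)) := by
          refine Finset.sum_le_sum fun j _ => ?_
          rw [abs_mul]
          have h4 := hlam k j
          rw [abs_of_pos hh] at h4
          calc |d j| * |lam k j| ≤ h / (4 * (1 + n)) * (Real.pi / h) :=
                mul_le_mul (hclose j) h4 (abs_nonneg _) (by positivity)
            _ = Real.pi / 4 * (1 / (1 + n)) := by field_simp
            _ ≤ 1 * (1 / (1 + n)) := by
                gcongr
                linarith [Real.pi_le_four]
            _ = 1 / (1 + n) := one_mul _
        _ = n / (1 + n) := by simp [div_eq_mul_inv]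
    have h4 : ‖w - 1‖ < 1 := by
      have h5 : w - 1 = (expo (lam k) (fun j => (τ j : ℂ)) - 1) -
          w * (expo (lam k) (fun j => (d j : ℂ)) - 1) := by rw [h2]; ring
      have h6 : ‖w‖ = 1 := norm_expo_ofReal (lam k) (fun j => h * round (τ j / h))
      rw [h5]
      calc _ ≤ _ := norm_sub_le _ _
        _ < 1 / (1 + n) + n / (1 + n) := by
          rw [norm_mul, h6, one_mul]; exact add_lt_add_of_lt_of_le h1 h3
        _ = 1 := by field_simp
    have h7 := Complex.abs_re_le_norm (w - 1)
    rw [Complex.sub_re, Complex.one_re] at h7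
    linarith [(abs_lt.1 (h7.trans_lt h4)).1]
  obtain ⟨a, ha, b, hb, c', hc', d, hd, heq⟩ := hψ _ hre
  -- Four elements of `A` cost `2ε` each and the distance to the lattice costs one more `ε`, whence
  -- `9ε`.
  have h1 := hadd _ _ _ _ (hadd _ _ _ _ (hadd _ _ _ _ ha hb) (hneg _ _ hc')) (hneg _ _ hd)
  have h2 : (fun j => τ j - h * round (τ j / h)) ∈ P ε := by
    refine hP _ fun j => (hclose j).trans ?_
    rw [div_le_iff₀ (by positivity)]
    have : 0 ≤ h * n := by positivity
    nlinarith
  have h3 := hadd _ _ _ _ h1 h2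
  convert h3 using 1
  · ring_nf
  · funext j
    have h4 := congrFun heq j
    simp only [Pi.add_apply, Pi.sub_apply] at h4
    simp only [Pi.add_apply, Pi.neg_apply]
    rw [h4]; push_cast; ring

/-! ### Subtubes and almost periods of holomorphic almost periodic mappings -/

variable {n m : ℕ} {Ω Ω' : Set (Fin n → ℝ)}

lemma HAP.ext_toFun {F G : HAP Ω m} (h : ∀ z l, F.toFun z l = G.toFun z l) : F = G := by
  cases F; cases G
  simp only [HAP.mk.injEq]
  funext z l
  exact h z l

lemma translate_mem_subtube {z : tube Ω} (hz : z ∈ subtube Ω Ω') (t : Fin n → ℝ) :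
    translate z t ∈ subtube Ω Ω' := by
  show (fun j => (z.1 j + (t j : ℂ)).im) ∈ Ω'
  have : (fun j => (z.1 j + (t j : ℂ)).im) = fun j => (z.1 j).im := by funext j; simp
  rw [this]; exact hz

lemma translate_translate (z : tube Ω) (s t : Fin n → ℝ) :
    translate (translate z s) t = translate z (s + t) := by
  apply Subtype.ext; funext j; simp [translate, add_assoc]

lemma translate_zero (z : tube Ω) : translate z 0 = z := by
  apply Subtype.ext; funext j; simp [translate]

lemma expo_translate (lam : Fin n → ℝ) (z : tube Ω) (t : Fin n → ℝ) :
    expo lam (translate z t).1 = expo lam z.1 * expo lam (fun j => (t j : ℂ)) :=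
  expo_add lam z.1 _

lemma continuous_translate (z : tube Ω) : Continuous (translate z) := by
  unfold translate
  fun_prop

lemma relCompact_singleton (y : Ω) : RelCompact {y.1} Ω := by
  unfold RelCompact
  simp

lemma IsHolomorphic.continuous {F : tube Ω → Fin m → ℂ} (h : IsHolomorphic F) :
    Continuous F := by
  obtain ⟨G, hG, hFG⟩ := h
  have : F = (tube Ω).domRestrict G := funext hFG
  rw [this]
  exact continuousOn_iff_continuous_domRestrict.1 hG.continuousOn

lemma continuous_expo (lam : Fin n → ℝ) : Continuous (expo lam) := by
  unfold expo pairing; fun_prop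

/-- The points of `ℂⁿ` with real parts in `[-T, T]` and imaginary part in `K`. -/
def box (T : ℝ) (K : Set (Fin n → ℝ)) : Set (Fin n → ℂ) :=
  (fun p : (Fin n → ℝ) × (Fin n → ℝ) => fun j => (p.1 j : ℂ) + (p.2 j : ℂ) * Complex.I) ''
    (Set.Icc (fun _ => -T) (fun _ => T) ×ˢ K)

lemma isCompact_box (T : ℝ) {K : Set (Fin n → ℝ)} (hK : IsCompact K) : IsCompact (box T K) :=
  (isCompact_Icc.prod hK).image (by fun_prop)

lemma mem_box {T : ℝ} {K : Set (Fin n → ℝ)} {z : Fin n → ℂ} (hz : ∀ j, |(z j).re| ≤ T)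
    (hz' : (fun j => (z j).im) ∈ K) : z ∈ box T K := by
  refine ⟨(fun j => (z j).re, fun j => (z j).im), ⟨⟨fun j => ?_, fun j => ?_⟩, hz'⟩, ?_⟩
  · exact (abs_le.1 (hz j)).1
  · exact (abs_le.1 (hz j)).2
  · funext j; exact Complex.re_add_im _

lemma box_subset_tube {T : ℝ} {K : Set (Fin n → ℝ)} (hK : K ⊆ Ω) : box T K ⊆ tube Ω := by
  rintro _ ⟨⟨x, y⟩, ⟨-, hy⟩, rfl⟩
  show (fun j => ((x j : ℂ) + (y j : ℂ) * Complex.I).im) ∈ Ω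
  have : (fun j => ((x j : ℂ) + (y j : ℂ) * Complex.I).im) = y := by funext j; simp
  rw [this]; exact hK hy

/-- The `ε`-almost periods of `F` on a subtube. -/
def perSet (F : HAP Ω m) (Ω' : Set (Fin n → ℝ)) (ε : ℝ) : Set (Fin n → ℝ) :=
  {τ | ∀ z ∈ subtube Ω Ω', ∀ l, ‖F.toFun (translate z τ) l - F.toFun z l‖ ≤ ε}

lemma add_mem_perSet (F : HAP Ω m) {ε δ : ℝ} {a b : Fin n → ℝ} (ha : a ∈ perSet F Ω' ε)
    (hb : b ∈ perSet F Ω' δ) : a + b ∈ perSet F Ω' (ε + δ) := by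
  intro z hz l
  have h1 := ha z hz l
  have h2 := hb _ (translate_mem_subtube hz a) l
  rw [translate_translate] at h2
  have := norm_add_le (F.toFun (translate z (a + b)) l - F.toFun (translate z a) l)
    (F.toFun (translate z a) l - F.toFun z l)
  rw [sub_add_sub_cancel] at this
  linarith

lemma neg_mem_perSet (F : HAP Ω m) {ε : ℝ} {a : Fin n → ℝ} (ha : a ∈ perSet F Ω' ε) :
    -a ∈ perSet F Ω' ε := by
  intro z hz l
  have h1 := ha _ (translate_mem_subtube hz (-a)) l
  rw [translate_translate, neg_add_cancel, translate_zero, norm_sub_rev] at h1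
  exact h1

lemma exists_perSet_dense (F : HAP Ω m) (hΩ' : RelCompact Ω' Ω) {ε : ℝ} (hε : 0 < ε) :
    ∃ T : ℝ, ∀ ξ : Fin n → ℝ, ∃ τ ∈ perSet F Ω' ε, ∀ j, |τ j - ξ j| ≤ T := by
  obtain ⟨t, ht, h⟩ := F.almostPeriodic ε hε Ω' hΩ'
  refine ⟨∑ l, t l, fun ξ => ?_⟩
  obtain ⟨τ, hτ, hF⟩ := h ξ
  refine ⟨τ, fun z hz l => (hF z hz l).le, fun j => (hτ j).le.trans ?_⟩
  exact Finset.single_le_sum (fun i _ => (ht i).le) (Finset.mem_univ j)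

/-- This replaces compactness of the subtube: up to `ε`, every value of `F` on it is taken in a
fixed compact box. -/
lemma exists_translate_mem_box (F : HAP Ω m) (hΩ' : RelCompact Ω' Ω) {ε : ℝ} (hε : 0 < ε) :
    ∃ T : ℝ, ∀ z ∈ subtube Ω Ω', ∃ τ ∈ perSet F Ω' ε,
      ∀ j, |((translate z τ).1 j).re| ≤ T := by
  obtain ⟨T, hT⟩ := exists_perSet_dense F hΩ' hε
  refine ⟨T, fun z _ => ?_⟩
  obtain ⟨τ, hτ, h⟩ := hT fun j => -(z.1 j).re
  refine ⟨τ, hτ, fun j => ?_⟩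
  have := h j
  rw [sub_neg_eq_add, add_comm] at this
  simpa [translate] using this

lemma exists_bound_subtube (F : HAP Ω m) (hΩ' : RelCompact Ω' Ω) :
    ∃ B : ℝ, 0 ≤ B ∧ ∀ z ∈ subtube Ω Ω', ∀ l, ‖F.toFun z l‖ ≤ B := by
  obtain ⟨G, hG, hFG⟩ := F.holomorphic
  obtain ⟨T, hT⟩ := exists_translate_mem_box F hΩ' one_pos
  obtain ⟨B, hB⟩ := (isCompact_box T hΩ'.1).exists_bound_of_continuousOn
    (hG.continuousOn.mono (box_subset_tube hΩ'.2))
  refine ⟨max B 0 + 1, by positivity, fun z hz l => ?_⟩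
  obtain ⟨τ, hτ, hb⟩ := hT z hz
  have h1 := hτ z hz l
  have h2 := hB _ (mem_box hb (subset_closure (translate_mem_subtube hz τ)))
  rw [← hFG] at h2
  have h3 := (norm_le_pi_norm (F.toFun (translate z τ)) l).trans h2
  have h4 := norm_sub_le (F.toFun (translate z τ) l) (F.toFun (translate z τ) l - F.toFun z l)
  rw [sub_sub_cancel] at h4
  have := le_max_left B 0
  linarith

/-- Uniform continuity in the real directions: a single almost period moves `z` and `z + s` into one
compact box, on which `F` is uniformly continuous. The bound `r ≤ 1` keeps the second point in the
box of half-side `T + 1`. -/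
lemma exists_perSet_nhds (F : HAP Ω m) (hΩ' : RelCompact Ω' Ω) {ε : ℝ} (hε : 0 < ε) :
    ∃ r : ℝ, 0 < r ∧ ∀ τ : Fin n → ℝ, (∀ j, |τ j| ≤ r) → τ ∈ perSet F Ω' ε := by
  obtain ⟨G, hG, hFG⟩ := F.holomorphic
  obtain ⟨T, hT⟩ := exists_translate_mem_box F hΩ' (ε := ε / 3) (by positivity)
  have hu := (isCompact_box (T + 1) hΩ'.1).uniformContinuousOn_of_continuous
    (hG.continuousOn.mono (box_subset_tube hΩ'.2))
  obtain ⟨δ, hδ, h⟩ := Metric.uniformContinuousOn_iff.1 hu (ε / 3) (by positivity)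
  refine ⟨min (δ / 2) 1, by positivity, fun s hs z hz l => ?_⟩
  obtain ⟨τ, hτ, hb⟩ := hT z hz
  have h1 := hτ z hz l
  have h2 := hτ _ (translate_mem_subtube hz s) l
  have h3 : ‖F.toFun (translate (translate z s) τ) l - F.toFun (translate z τ) l‖ ≤ ε / 3 := by
    have h4 : translate (translate z s) τ = translate (translate z τ) s := by
      rw [translate_translate, translate_translate, add_comm]
    rw [h4, hFG, hFG, ← dist_eq_norm]
    refine (dist_le_pi_dist _ _ l).trans (h _ ?_ _ ?_ ?_).le
    · refine mem_box (fun j => ?_)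
        (subset_closure (translate_mem_subtube (translate_mem_subtube hz τ) s))
      have h5 := hb j
      have h6 := (hs j).trans (min_le_right _ _)
      have h7 := abs_add_le ((translate z τ).1 j).re (s j)
      have h8 : ((translate (translate z τ) s).1 j).re = ((translate z τ).1 j).re + s j := by
        simp [translate]
      rw [h8]; linarith
    · exact mem_box (fun j => by linarith [hb j]) (subset_closure (translate_mem_subtube hz τ))
    · rw [dist_pi_lt_iff hδ]
      intro j
      have h6 := (hs j).trans (min_le_left _ _)
      rw [dist_eq_norm]
      simp only [translate, add_sub_cancel_left, Complex.norm_real, Real.norm_eq_abs]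
      linarith
  have h9 : F.toFun (translate z s) l - F.toFun z l =
      -(F.toFun (translate (translate z s) τ) l - F.toFun (translate z s) l) +
      (F.toFun (translate (translate z s) τ) l - F.toFun (translate z τ) l) +
      (F.toFun (translate z τ) l - F.toFun z l) := by ring
  rw [h9]
  refine (norm_add₃_le).trans ?_
  rw [norm_neg]
  linarith

/-- The almost periods of a holomorphic almost periodic mapping on a subtube contain a Bohr set. -/
theorem exists_bohr_set (F : HAP Ω m) (hΩ' : RelCompact Ω' Ω) {ε : ℝ} (hε : 0 < ε) :
    ∃ (Λ : Finset (Fin n → ℝ)) (δ : ℝ), 0 < δ ∧ ∀ τ : Fin n → ℝ,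
      (∀ lam ∈ Λ, ‖expo lam (fun j => (τ j : ℂ)) - 1‖ < δ) → τ ∈ perSet F Ω' ε := by
  obtain ⟨Λ, δ, hδ, h⟩ := exists_bohr_set_real (perSet F Ω')
    (fun _ _ _ _ => add_mem_perSet F) (fun _ _ => neg_mem_perSet F) (ε / 9)
    (exists_perSet_nhds F hΩ' (by positivity)) (exists_perSet_dense F hΩ' (by positivity))
  refine ⟨Λ, δ, hδ, fun τ hτ => ?_⟩
  have := h τ hτ
  rwa [mul_div_cancel₀ _ (by norm_num : (9 : ℝ) ≠ 0)] at this

/-! ### The compact group `Ch ℝⁿ` and exponential sums on it -/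

lemma isInducing_coe_ch (n : ℕ) :
    IsInducing (fun (χ : Ch n) (lam : Fin n → ℝ) => χ lam) := ⟨rfl⟩

lemma continuous_eval_ch (lam : Fin n → ℝ) : Continuous fun χ : Ch n => χ lam :=
  (continuous_apply lam).comp (isInducing_coe_ch n).continuous

lemma continuous_coe_ch (lam : Fin n → ℝ) : Continuous fun χ : Ch n => (χ lam : ℂ) :=
  continuous_subtype_val.comp (continuous_eval_ch lam)

/-- The homomorphism equations are closed conditions in the product of circles, so compactness is
inherited from Tychonoff's theorem. -/
lemma isClosedEmbedding_coe_ch (n : ℕ) :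
    IsClosedEmbedding (fun (χ : Ch n) (lam : Fin n → ℝ) => χ lam) := by
  refine ⟨⟨isInducing_coe_ch n, fun _ _ h => DFunLike.coe_injective h⟩, ?_⟩
  have : Set.range (fun (χ : Ch n) (lam : Fin n → ℝ) => χ lam) =
      {f | f 0 = 1 ∧ ∀ a b, f (a + b) = f a * f b} := by
    ext f
    constructor
    · rintro ⟨χ, rfl⟩
      exact ⟨AddChar.map_zero_eq_one χ, AddChar.map_add_eq_mul χ⟩
    · rintro ⟨h0, h1⟩
      exact ⟨⟨f, h0, h1⟩, rfl⟩
  rw [this, Set.ofPred_and]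
  refine (isClosed_eq (by fun_prop) (by fun_prop)).inter ?_
  simp only [Set.ofPred_forall]
  exact isClosed_iInter fun a => isClosed_iInter fun b => isClosed_eq (by fun_prop) (by fun_prop)

instance (n : ℕ) : CompactSpace (Ch n) := (isClosedEmbedding_coe_ch n).compactSpace

instance (n : ℕ) : T2Space (Ch n) := (isClosedEmbedding_coe_ch n).isEmbedding.t2Space

/-- The continuous character `lam ↦ e^{i⟨t, lam⟩}`. -/
def realChar (t : Fin n → ℝ) : Ch n where
  toFun lam := Circle.exp (∑ j, t j * lam j)
  map_zero_eq_one' := by simp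
  map_add_eq_mul' a b := by
    rw [← Circle.exp_add, ← Finset.sum_add_distrib]
    congr 1
    exact Finset.sum_congr rfl fun j _ => by simp [mul_add]

lemma coe_realChar (t lam : Fin n → ℝ) :
    ((realChar t lam : Circle) : ℂ) = expo lam (fun j => (t j : ℂ)) := by
  rw [expo_ofReal, mul_comm]
  exact Circle.coe_exp _

/-- The value of a formal exponential sum at a character. -/
def evalCh (χ : Ch n) : AddMonoidAlgebra ℂ (Fin n → ℝ) →ₐ[ℂ] ℂ :=
  AddMonoidAlgebra.lift ℂ ℂ (Fin n → ℝ) (Circle.coeHom.comp χ.toMonoidHom)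

lemma evalCh_apply (χ : Ch n) (p : AddMonoidAlgebra ℂ (Fin n → ℝ)) :
    evalCh χ p = ∑ lam ∈ p.coeff.support, p.coeff lam * (χ lam : ℂ) :=
  AddMonoidAlgebra.lift_apply' _ _

lemma evalCh_single (χ : Ch n) (lam : Fin n → ℝ) (c : ℂ) :
    evalCh χ (AddMonoidAlgebra.single lam c) = c * (χ lam : ℂ) :=
  AddMonoidAlgebra.lift_single _ _ _

/-- Conjugation replaces a frequency by its negative. This is the closure under `star` that the
complex Stone-Weierstrass theorem requires. -/
lemma exists_conj_evalCh (p : AddMonoidAlgebra ℂ (Fin n → ℝ)) :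
    ∃ q, ∀ χ : Ch n, star (evalCh χ p) = evalCh χ q := by
  induction p using AddMonoidAlgebra.induction_linear with
  | zero => exact ⟨0, fun χ => by simp⟩
  | add p q hp hq =>
    obtain ⟨p', hp⟩ := hp
    obtain ⟨q', hq⟩ := hq
    exact ⟨p' + q', fun χ => by rw [map_add, map_add, star_add, hp, hq]⟩
  | single lam c =>
    refine ⟨AddMonoidAlgebra.single (-lam) (star c), fun χ => ?_⟩
    rw [evalCh_single, evalCh_single, AddChar.map_neg_eq_inv, Circle.coe_inv_eq_conj, star_mul']
    rfl

/-- The continuous functions on the character group that are given by exponential sums. -/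
def expSubalgebra (n : ℕ) : StarSubalgebra ℂ C(Ch n, ℂ) where
  carrier := {g | ∃ p, ∀ χ, g χ = evalCh χ p}
  mul_mem' := by
    rintro f g ⟨p, hp⟩ ⟨q, hq⟩
    exact ⟨p * q, fun χ => by rw [map_mul, ← hp, ← hq]; rfl⟩
  add_mem' := by
    rintro f g ⟨p, hp⟩ ⟨q, hq⟩
    exact ⟨p + q, fun χ => by rw [map_add, ← hp, ← hq]; rfl⟩
  algebraMap_mem' := fun c => ⟨algebraMap ℂ _ c, fun χ => by rw [AlgHom.commutes]; rfl⟩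
  star_mem' := by
    rintro f ⟨p, hp⟩
    obtain ⟨q, hq⟩ := exists_conj_evalCh p
    exact ⟨q, fun χ => by rw [← hq, ← hp]; rfl⟩

/-- Exponential sums are dense in the continuous functions on the character group. -/
lemma exists_evalCh_approx (g : C(Ch n, ℂ)) {ε : ℝ} (hε : 0 < ε) :
    ∃ p, ∀ χ, ‖g χ - evalCh χ p‖ < ε := by
  have hsep : (expSubalgebra n).SeparatesPoints := by
    intro χ χ' hne
    obtain ⟨lam, hlam⟩ := DFunLike.ne_iff.1 hne
    refine ⟨_, ⟨⟨fun χ => (χ lam : ℂ), continuous_coe_ch lam⟩,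
      ⟨AddMonoidAlgebra.single lam 1, fun χ => by rw [evalCh_single, one_mul]; rfl⟩, rfl⟩, ?_⟩
    exact fun h => hlam (Circle.coe_injective h)
  have h := ContinuousMap.starSubalgebra_topologicalClosure_eq_top_of_separatesPoints _ hsep
  have hg : g ∈ (expSubalgebra n).topologicalClosure := by rw [h]; trivial
  obtain ⟨g', ⟨p, hp⟩, hd⟩ := Metric.mem_closure_iff.1 hg ε hε
  refine ⟨p, fun χ => ?_⟩
  rw [← hp, ← dist_eq_norm]
  exact (ContinuousMap.dist_apply_le_dist χ).trans_lt hd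

/-! ### Uniform approximation by exponential sums -/

lemma IsHolomorphic.translate (F : HAP Ω m) (t : Fin n → ℝ) :
    IsHolomorphic fun z : tube Ω => F.toFun (translate z t) := by
  obtain ⟨G, hG, hFG⟩ := F.holomorphic
  refine ⟨fun z => G fun j => z j + (t j : ℂ), ?_, fun z => hFG _⟩
  refine hG.comp (Differentiable.differentiableOn (by fun_prop)) fun z hz => ?_
  exact (AlmostPeriodic.translate ⟨z, hz⟩ t).2

/-- `F` is approximated on a subtube, up to `ε` and in all real directions, by exponential sums
with frequencies in `Λ` and coefficients `G`. -/
structure IsApprox (F : HAP Ω m) (Ω' : Set (Fin n → ℝ)) (ε : ℝ) (Λ : Finset (Fin n → ℝ))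
    (G : (Fin n → ℝ) → tube Ω → Fin m → ℂ) : Prop where
  bounded : ∀ lam, ∃ B : ℝ, ∀ z ∈ subtube Ω Ω', ∀ l, ‖G lam z l‖ ≤ B
  approx : ∀ z ∈ subtube Ω Ω', ∀ t l,
    ‖F.toFun (translate z t) l -
      ∑ lam ∈ Λ, G lam z l * expo lam (fun j => (t j : ℂ))‖ ≤ ε

/-- The approximation theorem for almost periodic functions. -/
theorem exists_isApprox (F : HAP Ω m) (hΩ' : RelCompact Ω' Ω) {ε : ℝ} (hε : 0 < ε) :
    ∃ Λ G, IsApprox F Ω' ε Λ G ∧ ∀ lam, IsHolomorphic (G lam) := by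
  classical
  obtain ⟨Λ₀, δ, hδ, hΛ₀⟩ := exists_bohr_set F hΩ' (half_pos hε)
  obtain ⟨B, hB0, hB⟩ := exists_bound_subtube F hΩ'
  -- If `realChar t` lies in `U k`, then `t - k` belongs to the Bohr set and is an `ε / 2`-almost
  -- period, so `F(z + t)` is close to `F(z + k)`.
  let U : (Fin n → ℝ) → Set (Ch n) := fun t =>
    {χ | ∀ lam ∈ Λ₀, ‖(χ lam : ℂ) - (realChar t lam : ℂ)‖ < δ}
  have hUo : ∀ t, IsOpen (U t) := by
    intro t
    simp only [U, Set.ofPred_forall]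
    refine isOpen_biInter_finset fun lam _ => isOpen_lt ?_ continuous_const
    exact ((continuous_coe_ch lam).sub continuous_const).norm
  have hcover : closure (Set.range (realChar (n := n))) ⊆ ⋃ t, U t := by
    intro χ hχ
    let V : Set (Ch n) := {χ' | ∀ lam ∈ Λ₀, ‖(χ lam : ℂ) - (χ' lam : ℂ)‖ < δ}
    have hV : IsOpen V := by
      simp only [V, Set.ofPred_forall]
      refine isOpen_biInter_finset fun lam _ => isOpen_lt ?_ continuous_const
      exact (continuous_const.sub (continuous_coe_ch lam)).norm
    obtain ⟨_, hV', t, rfl⟩ := mem_closure_iff.1 hχ V hV (fun lam _ => by simpa using hδ)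
    exact Set.mem_iUnion.2 ⟨t, hV'⟩
  -- The closure of the continuous characters is compact, and covering it suffices: no density in
  -- `Ch ℝⁿ` is needed.
  obtain ⟨T, hT⟩ := isClosed_closure.isCompact.elim_finite_subcover U hUo hcover
  obtain ⟨f, hf⟩ := PartitionOfUnity.exists_isSubordinate
    (isClosed_closure (s := Set.range (realChar (n := n)))) (fun t : T => U t) (fun t => hUo t)
    (hT.trans (Set.iUnion₂_subset fun t ht =>
      Set.subset_iUnion_of_subset (⟨t, ht⟩ : T) subset_rfl))
  set η : ℝ := ε / (2 * ((T.card : ℝ) * B + 1)) with hη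
  have hTB : 0 < (T.card : ℝ) * B + 1 := by positivity
  have hη0 : 0 < η := by positivity
  -- Each function of the partition of unity is replaced by an exponential sum up to `η`; since `F`
  -- is bounded by `B`, this costs at most `η |T| B ≤ ε / 2`.
  choose p hp using fun t : T => exists_evalCh_approx
    (⟨fun χ => ((f t χ : ℝ) : ℂ), by fun_prop⟩ : C(Ch n, ℂ)) hη0
  refine ⟨Finset.univ.biUnion fun k => (p k).coeff.support,
    fun lam z l => ∑ k, (p k).coeff lam * F.toFun (translate z k) l, ⟨?_, ?_⟩, fun lam => ?_⟩
  · intro lam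
    refine ⟨∑ k, ‖(p k).coeff lam‖ * B, fun z hz l => norm_sum_le_of_le _ fun k _ => ?_⟩
    rw [norm_mul]
    exact mul_le_mul_of_nonneg_left (hB _ (translate_mem_subtube hz _) l) (norm_nonneg _)
  · intro z hz t l
    have h1 : ∑ lam ∈ Finset.univ.biUnion (fun k => (p k).coeff.support),
        (∑ k, (p k).coeff lam * F.toFun (translate z k) l) * expo lam (fun j => (t j : ℂ)) =
        ∑ k, evalCh (realChar t) (p k) * F.toFun (translate z k) l := by
      simp only [Finset.sum_mul]
      rw [Finset.sum_comm]
      refine Finset.sum_congr rfl fun k _ => ?_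
      rw [evalCh_apply, Finset.sum_mul]
      symm
      have hsub : (p k).coeff.support ⊆ Finset.univ.biUnion (fun k => (p k).coeff.support) :=
        Finset.subset_biUnion_of_mem (fun k => (p k).coeff.support) (Finset.mem_univ k)
      rw [Finset.sum_subset hsub]
      · refine Finset.sum_congr rfl fun lam _ => ?_
        rw [coe_realChar]; ring
      · intro lam _ h
        rw [Finsupp.notMem_support_iff.1 h]; simp
    have hone : ∑ k, f k (realChar t) = 1 := by
      rw [← finsum_eq_sum_of_fintype]
      exact f.sum_eq_one (subset_closure ⟨t, rfl⟩)
    have h2 : ‖F.toFun (translate z t) l -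
        ∑ k, (f k (realChar t) : ℂ) * F.toFun (translate z k) l‖ ≤ ε / 2 := by
      have h3 : F.toFun (translate z t) l =
          ∑ k, (f k (realChar t) : ℂ) * F.toFun (translate z t) l := by
        rw [← Finset.sum_mul, ← Complex.ofReal_sum, hone]; simp
      rw [h3, ← Finset.sum_sub_distrib]
      calc _ ≤ ∑ k, f k (realChar t) * (ε / 2) := by
            refine norm_sum_le_of_le _ fun k _ => ?_
            rw [← mul_sub, norm_mul, Complex.norm_real, Real.norm_of_nonneg (f.nonneg k _)]
            by_cases hk : f k (realChar t) = 0
            · simp [hk]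
            refine mul_le_mul_of_nonneg_left ?_ (f.nonneg k _)
            have hk' : realChar t ∈ U k := hf k (subset_tsupport _ hk)
            have h4 : t - k.1 ∈ perSet F Ω' (ε / 2) := by
              refine hΛ₀ _ fun lam hlam => ?_
              have h5 := hk' lam hlam
              rw [coe_realChar, coe_realChar] at h5
              have h6 : expo lam (fun j => (t j : ℂ)) =
                  expo lam (fun j => ((t - k.1) j : ℂ)) * expo lam (fun j => (k.1 j : ℂ)) := by
                rw [← expo_ofReal_add, sub_add_cancel]
              rw [h6, ← sub_one_mul, norm_mul, norm_expo_ofReal, mul_one] at h5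
              exact h5
            have h7 := h4 _ (translate_mem_subtube hz k.1) l
            rwa [translate_translate, add_sub_cancel] at h7
        _ = ε / 2 := by rw [← Finset.sum_mul, hone, one_mul]
    have h3 : ‖∑ k, (f k (realChar t) : ℂ) * F.toFun (translate z k) l -
        ∑ k, evalCh (realChar t) (p k) * F.toFun (translate z k) l‖ ≤ ε / 2 := by
      rw [← Finset.sum_sub_distrib]
      calc _ ≤ ∑ k : T, η * B := by
            refine norm_sum_le_of_le _ fun k _ => ?_
            rw [← sub_mul, norm_mul]
            exact mul_le_mul (hp k (realChar t)).le (hB _ (translate_mem_subtube hz _) l)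
              (norm_nonneg _) hη0.le
        _ = η * (T.card * B) := by simp; ring
        _ ≤ η * (T.card * B + 1) := by gcongr; linarith
        _ = ε / 2 := by rw [hη]; field_simp
    rw [h1]
    calc _ ≤ _ := norm_sub_le_norm_sub_add_norm_sub _
          (∑ k, (f k (realChar t) : ℂ) * F.toFun (translate z k) l) _
      _ ≤ ε := by linarith
  · choose G hG hFG using fun k : T => IsHolomorphic.translate F k.1
    refine ⟨fun z l => ∑ k, (p k).coeff lam * G k z l, ?_, fun z => ?_⟩
    · rw [differentiableOn_pi]
      intro l
      refine DifferentiableOn.fun_sum fun k _ => ?_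
      exact ((differentiableOn_pi.1 (hG k)) l).const_mul _
    · funext l
      refine Finset.sum_congr rfl fun k _ => ?_
      rw [← hFG k z]

/-! ### Means over cubes and Fourier-Bohr coefficients -/

/-- The open cube with half-side `s`. -/
def cube (n : ℕ) (s : ℝ) : Set (Fin n → ℝ) := {x | ∀ j, |x j| < s}

lemma cube_eq_pi (n : ℕ) (s : ℝ) : cube n s = Set.univ.pi fun _ => Set.Ioo (-s) s := by
  ext x; simp [cube, abs_lt, Set.mem_pi]

lemma volume_cube (n : ℕ) {s : ℝ} (hs : 0 ≤ s) : volume.real (cube n s) = (2 * s) ^ n := by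
  rw [cube_eq_pi, Measure.real, volume_pi_pi]
  simp only [Real.volume_Ioo, Finset.prod_const, Finset.card_univ, Fintype.card_fin,
    ENNReal.toReal_pow]
  rw [ENNReal.toReal_ofReal (by linarith)]
  ring

lemma volume_cube_lt_top (n : ℕ) (s : ℝ) : volume (cube n s) < ⊤ := by
  rw [cube_eq_pi, volume_pi_pi]
  simp

/-- The mean over the cube with half-side `s`. -/
def avg (s : ℝ) (g : (Fin n → ℝ) → ℂ) : ℂ := (1 / (2 * (s : ℂ)) ^ n) * ∫ x in cube n s, g x

lemma integrableOn_cube {g : (Fin n → ℝ) → ℂ} (hg : Continuous g) (s : ℝ) :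
    IntegrableOn g (cube n s) := by
  refine (hg.continuousOn.integrableOn_compact
    (isCompact_Icc (a := fun _ : Fin n => -s) (b := fun _ => s))).mono_set ?_
  intro x hx
  exact ⟨fun j => (abs_lt.1 (hx j)).1.le, fun j => (abs_lt.1 (hx j)).2.le⟩

lemma avg_sub {g h : (Fin n → ℝ) → ℂ} (hg : Continuous g) (hh : Continuous h) (s : ℝ) :
    avg s (fun x => g x - h x) = avg s g - avg s h := by
  unfold avg
  rw [integral_sub (integrableOn_cube hg s) (integrableOn_cube hh s), mul_sub]

lemma avg_sum {ι : Type*} (t : Finset ι) {g : ι → (Fin n → ℝ) → ℂ}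
    (hg : ∀ i ∈ t, Continuous (g i)) (s : ℝ) :
    avg s (fun x => ∑ i ∈ t, g i x) = ∑ i ∈ t, avg s (g i) := by
  unfold avg
  rw [integral_finsetSum _ fun i hi => integrableOn_cube (hg i hi) s, Finset.mul_sum]

lemma avg_const_mul (c : ℂ) (g : (Fin n → ℝ) → ℂ) (s : ℝ) :
    avg s (fun x => c * g x) = c * avg s g := by
  unfold avg
  rw [integral_const_mul]
  ring

lemma norm_avg_le {g : (Fin n → ℝ) → ℂ} {M : ℝ} (hg : ∀ x, ‖g x‖ ≤ M) {s : ℝ} (hs : 0 < s) :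
    ‖avg s g‖ ≤ M := by
  have h := norm_setIntegral_le_of_norm_le_const (volume_cube_lt_top n s) fun x _ => hg x
  rw [volume_cube n hs.le] at h
  unfold avg
  rw [norm_mul]
  have h1 : ‖(1 / (2 * (s : ℂ)) ^ n)‖ = 1 / (2 * s) ^ n := by
    simp [abs_of_pos hs]
  rw [h1]
  have h2 : 0 < (2 * s) ^ n := by positivity
  calc 1 / (2 * s) ^ n * ‖∫ x in cube n s, g x‖ ≤ 1 / (2 * s) ^ n * (M * (2 * s) ^ n) := by
        gcongr
    _ = M := by field_simp

/-- Multiplication by a bounded function increases the mean of a non-negative function by the bound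
at most. -/
lemma norm_avg_mul_le {k h : (Fin n → ℝ) → ℂ} (hk : Continuous k)
    (hk0 : ∀ x, k x = (‖k x‖ : ℂ)) {M : ℝ} (hM : ∀ x, ‖h x‖ ≤ M) (s : ℝ) :
    ‖avg s (fun x => k x * h x)‖ ≤ M * ‖avg s k‖ := by
  have h1 : ‖∫ x in cube n s, k x‖ = ∫ x in cube n s, ‖k x‖ := by
    rw [setIntegral_congr_fun (g := fun x => ((‖k x‖ : ℝ) : ℂ))
      (by rw [cube_eq_pi]; exact MeasurableSet.univ_pi fun _ => measurableSet_Ioo)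
      fun x _ => hk0 x, integral_complex_ofReal, Complex.norm_real, Real.norm_of_nonneg]
    exact integral_nonneg fun x => norm_nonneg _
  have h2 : ‖∫ x in cube n s, k x * h x‖ ≤ M * ∫ x in cube n s, ‖k x‖ := by
    rw [← integral_const_mul]
    refine norm_integral_le_of_norm_le ((integrableOn_cube hk s).norm.const_mul M) ?_
    refine Eventually.of_forall fun x => ?_
    rw [norm_mul, mul_comm]
    exact mul_le_mul_of_nonneg_right (hM x) (norm_nonneg _)
  unfold avg
  rw [norm_mul, norm_mul, h1]
  calc _ ≤ ‖1 / (2 * (s : ℂ)) ^ n‖ * (M * ∫ x in cube n s, ‖k x‖) := by gcongr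
    _ = _ := by ring

/-- For `a ≠ 0` the integrals are bounded by `2 / |a|` while the normalising factor tends to zero.
-/
lemma tendsto_mean_exp (a : ℝ) :
    Tendsto (fun s : ℝ => (1 / (2 * (s : ℂ))) *
      ∫ x in Set.Ioo (-s) s, Complex.exp (Complex.I * ((x * a : ℝ) : ℂ))) atTop
      (𝓝 (if a = 0 then 1 else 0)) := by
  split_ifs with ha
  · refine tendsto_const_nhds.congr' ?_
    filter_upwards [eventually_gt_atTop 0] with s hs
    subst ha
    have hs' : (s : ℂ) ≠ 0 := by exact_mod_cast hs.ne'
    simp only [mul_zero, Complex.ofReal_zero, Complex.exp_zero]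
    rw [setIntegral_const, Measure.real, Real.volume_Ioo, ENNReal.toReal_ofReal (by linarith)]
    simp only [Complex.real_smul]
    push_cast
    field_simp
    ring
  · have hc : (Complex.I * (a : ℂ)) ≠ 0 :=
      mul_ne_zero Complex.I_ne_zero (by exact_mod_cast ha)
    refine squeeze_zero_norm' (a := fun s : ℝ => 1 / |a| * (1 / s)) ?_ ?_
    · filter_upwards [eventually_gt_atTop 0] with s hs
      have h1 : ∫ x in Set.Ioo (-s) s, Complex.exp (Complex.I * ((x * a : ℝ) : ℂ)) =
          (Complex.exp (Complex.I * a * (s : ℝ)) - Complex.exp (Complex.I * a * ((-s : ℝ) : ℂ))) /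
            (Complex.I * a) := by
        rw [← integral_exp_mul_complex hc, intervalIntegral.integral_of_le (by linarith),
          integral_Ioc_eq_integral_Ioo]
        congr 1
        funext x
        congr 1
        push_cast
        ring
      have h2 : ∀ u : ℝ, ‖Complex.exp (Complex.I * a * (u : ℂ))‖ = 1 := by
        intro u; rw [Complex.norm_exp]; simp
      have h3 : ‖Complex.exp (Complex.I * a * (s : ℝ)) -
          Complex.exp (Complex.I * a * ((-s : ℝ) : ℂ))‖ ≤ 2 := by
        refine (norm_sub_le _ _).trans ?_
        rw [h2, h2]; norm_num
      have h4 : ‖(1 / (2 * (s : ℂ)))‖ = 1 / (2 * s) := by simp [abs_of_pos hs]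
      have h5 : ‖Complex.I * (a : ℂ)‖ = |a| := by simp
      rw [h1, norm_mul, h4, norm_div, h5]
      have ha' : 0 < |a| := abs_pos.2 ha
      calc _ ≤ 1 / (2 * s) * (2 / |a|) := by gcongr
        _ = _ := by field_simp
    · have := (tendsto_const_nhds (x := 1 / |a|)).mul
        (tendsto_const_nhds.div_atTop tendsto_id : Tendsto (fun s : ℝ => 1 / s) atTop (𝓝 0))
      simpa using this

/-- Orthogonality of the exponentials with respect to the mean. -/
lemma tendsto_avg_expo (mu : Fin n → ℝ) :
    Tendsto (fun s => avg s fun x => expo mu fun j => (x j : ℂ)) atTop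
      (𝓝 (if mu = 0 then 1 else 0)) := by
  classical
  have h1 : ∀ s, (avg s fun x => expo mu fun j => (x j : ℂ)) =
      ∏ j : Fin n, ((1 / (2 * (s : ℂ))) *
        ∫ x in Set.Ioo (-s) s, Complex.exp (Complex.I * ((x * mu j : ℝ) : ℂ))) := by
    intro s
    unfold avg
    rw [Finset.prod_mul_distrib, Finset.prod_const, Finset.card_univ, Fintype.card_fin,
      one_div_pow]
    congr 1
    rw [cube_eq_pi, volume_pi, Measure.restrict_pi_pi, ← integral_fintype_prod_eq_prod]
    congr 1
    funext x
    beta_reduce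
    rw [expo_ofReal, Complex.ofReal_sum, Finset.mul_sum, Complex.exp_sum]
  simp only [h1]
  have h2 := tendsto_finsetProd (Finset.univ : Finset (Fin n)) fun j _ => tendsto_mean_exp (mu j)
  convert h2 using 2
  rw [Finset.prod_ite_zero]
  simp only [Finset.mem_univ, true_implies, Finset.prod_const_one, funext_iff, Pi.zero_apply]

/-- The function `h` has the Fourier-Bohr coefficient `c` at the frequency `lam`. -/
def HasCoeff (h : (Fin n → ℝ) → ℂ) (lam : Fin n → ℝ) (c : ℂ) : Prop :=
  Tendsto (fun s : ℝ => avg s fun x => expo (-lam) (fun j => (x j : ℂ)) * h x) atTop (𝓝 c)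

lemma continuous_expo_ofReal (lam : Fin n → ℝ) :
    Continuous fun x : Fin n → ℝ => expo lam fun j => (x j : ℂ) :=
  (continuous_expo lam).comp (by fun_prop)

lemma continuous_expo_mul (lam : Fin n → ℝ) {h : (Fin n → ℝ) → ℂ} (hh : Continuous h) :
    Continuous fun x : Fin n → ℝ => expo lam (fun j => (x j : ℂ)) * h x :=
  (continuous_expo_ofReal lam).mul hh

lemma HasCoeff.unique {h : (Fin n → ℝ) → ℂ} {lam : Fin n → ℝ} {c c' : ℂ} (hc : HasCoeff h lam c)
    (hc' : HasCoeff h lam c') : c = c' :=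
  tendsto_nhds_unique hc hc'

lemma HasCoeff.sub {g h : (Fin n → ℝ) → ℂ} {lam : Fin n → ℝ} {c d : ℂ} (hg : Continuous g)
    (hh : Continuous h) (hc : HasCoeff g lam c) (hd : HasCoeff h lam d) :
    HasCoeff (fun x => g x - h x) lam (c - d) := by
  refine (Tendsto.sub hc hd).congr fun s => ?_
  rw [← avg_sub (continuous_expo_mul _ hg) (continuous_expo_mul _ hh)]
  simp only [mul_sub]

lemma HasCoeff.norm_le {h : (Fin n → ℝ) → ℂ} {lam : Fin n → ℝ} {c : ℂ} {M : ℝ}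
    (hc : HasCoeff h lam c) (hM : ∀ x, ‖h x‖ ≤ M) : ‖c‖ ≤ M := by
  refine le_of_tendsto (Tendsto.norm hc) ?_
  filter_upwards [eventually_gt_atTop 0] with s hs
  refine norm_avg_le (fun x => ?_) hs
  rw [norm_mul, norm_expo_ofReal, one_mul]
  exact hM x

/-- Orthogonality of exponentials. The family `μ` may repeat frequencies, so the coefficient
collects all indices over `lam`. -/
lemma hasCoeff_expSum {ι : Type*} (s : Finset ι) (c : ι → ℂ) (μ : ι → Fin n → ℝ)
    (lam : Fin n → ℝ) [DecidableEq (Fin n → ℝ)] :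
    HasCoeff (fun x => ∑ i ∈ s, c i * expo (μ i) fun j => (x j : ℂ)) lam
      (∑ i ∈ s, if μ i = lam then c i else 0) := by
  have h1 : Tendsto (fun r : ℝ => ∑ i ∈ s, c i * avg r fun x => expo (-lam + μ i)
      fun j => (x j : ℂ)) atTop (𝓝 (∑ i ∈ s, c i * if -lam + μ i = 0 then 1 else 0)) :=
    tendsto_finsetSum _ fun i _ => by
      have := tendsto_avg_expo (-lam + μ i)
      convert this.const_mul (c i) using 4
  have h2 : (∑ i ∈ s, if μ i = lam then c i else 0) =
      ∑ i ∈ s, c i * if -lam + μ i = 0 then 1 else 0 := by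
    refine Finset.sum_congr rfl fun i _ => ?_
    rw [mul_ite, mul_one, mul_zero]
    refine if_congr ?_ rfl rfl
    rw [neg_add_eq_zero, eq_comm]
  rw [h2]
  refine h1.congr fun r => ?_
  simp only [← avg_const_mul]
  rw [← avg_sum _ fun i _ => (continuous_expo_ofReal _).const_mul (c i)]
  congr 1
  funext x
  rw [Finset.mul_sum]
  refine Finset.sum_congr rfl fun i _ => ?_
  rw [expo_add_freq]; ring

/-- Uniform limits of exponential sums have Fourier-Bohr coefficients. -/
lemma exists_hasCoeff {h : (Fin n → ℝ) → ℂ} (hh : Continuous h)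
    (happ : ∀ ε : ℝ, 0 < ε → ∃ (Λ : Finset (Fin n → ℝ)) (c : (Fin n → ℝ) → ℂ),
      ∀ x, ‖h x - ∑ lam ∈ Λ, c lam * expo lam fun j => (x j : ℂ)‖ ≤ ε) (lam : Fin n → ℝ) :
    ∃ c, HasCoeff h lam c := by
  classical
  refine cauchySeq_tendsto_of_complete (Metric.cauchySeq_iff.2 fun ε hε => ?_)
  obtain ⟨Λ, c, hc⟩ := happ (ε / 4) (by positivity)
  have hq := (hasCoeff_expSum Λ c (fun mu => mu) lam).cauchySeq
  obtain ⟨N, hN⟩ := Metric.cauchySeq_iff.1 hq (ε / 4) (by positivity)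
  have hcont : Continuous fun x : Fin n → ℝ => ∑ lam ∈ Λ, c lam * expo lam fun j => (x j : ℂ) :=
    continuous_finsetSum _ fun i _ => (continuous_expo_ofReal _).const_mul _
  have hclose : ∀ s : ℝ, 0 < s →
      ‖avg s (fun x => expo (-lam) (fun j => (x j : ℂ)) * h x) -
        avg s (fun x => expo (-lam) (fun j => (x j : ℂ)) *
          ∑ mu ∈ Λ, c mu * expo mu fun j => (x j : ℂ))‖ ≤ ε / 4 := by
    intro s hs
    rw [← avg_sub (continuous_expo_mul _ hh) (continuous_expo_mul _ hcont)]
    refine norm_avg_le (fun x => ?_) hs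
    rw [← mul_sub, norm_mul, norm_expo_ofReal, one_mul]
    exact hc x
  refine ⟨max N 1, fun a ha b hb => ?_⟩
  have h1 := hN a (le_trans (le_max_left _ _) ha) b (le_trans (le_max_left _ _) hb)
  have h2 := hclose a (lt_of_lt_of_le one_pos (le_trans (le_max_right _ _) ha))
  have h3 := hclose b (lt_of_lt_of_le one_pos (le_trans (le_max_right _ _) hb))
  rw [← dist_eq_norm] at h2 h3
  rw [dist_comm] at h3
  refine (dist_triangle4 _ _ _ _).trans_lt (lt_of_le_of_lt (add_le_add_three h2 h1.le h3) ?_)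
  linarith

/-! ### Holomorphy of limits and the Bohr transform -/

lemma expo_zero (lam : Fin n → ℝ) : expo lam (fun _ => 0) = 1 := by
  simp [expo, pairing]

lemma expo_neg_mul_expo (lam : Fin n → ℝ) (z : Fin n → ℂ) : expo (-lam) z * expo lam z = 1 := by
  rw [← expo_add_freq, neg_add_cancel]
  simp [expo, pairing]

/-- Uniform limits of holomorphic functions on a ball of a normed space are holomorphic. -/
lemma differentiableAt_of_tendstoUniformlyOn_ball {E : Type*} [NormedAddCommGroup E]
    [NormedSpace ℂ E] {f : ℕ → E → ℂ} {g : E → ℂ} {c : E} {r : ℝ} (hr : 0 < r)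
    (hf : ∀ k, DifferentiableOn ℂ (f k) (Metric.ball c (2 * r)))
    (h : TendstoUniformlyOn f g atTop (Metric.ball c (2 * r))) : DifferentiableAt ℂ g c := by
  have hsub : ∀ z ∈ Metric.ball c r, Metric.ball z r ⊆ Metric.ball c (2 * r) := by
    intro z hz
    refine Metric.ball_subset_ball' ?_
    rw [Metric.mem_ball] at hz
    linarith
  -- Cauchy's estimate on balls of radius `r` about the points of the smaller ball turns uniform
  -- closeness of the functions into uniform closeness of their derivatives.
  have hc : UniformCauchySeqOn (fun k z => fderiv ℂ (f k) z) atTop (Metric.ball c r) := by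
    rw [Metric.uniformCauchySeqOn_iff]
    intro ε hε
    obtain ⟨N, hN⟩ := Metric.uniformCauchySeqOn_iff.1 h.uniformCauchySeqOn (ε * r / 4)
      (by positivity)
    refine ⟨N, fun i hi j hj z hz => ?_⟩
    have hd : ∀ k, DifferentiableOn ℂ (f k) (Metric.ball z r) := fun k => (hf k).mono (hsub z hz)
    have hdz : ∀ k, DifferentiableAt ℂ (f k) z := fun k =>
      (hd k).differentiableAt (Metric.ball_mem_nhds z hr)
    have h1 : ‖fderiv ℂ (fun w => f i w - f j w) z‖ ≤ (ε * r / 2) / r := by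
      refine Complex.norm_fderiv_le_div_of_mapsTo_ball ((hd i).sub (hd j)) (fun w hw => ?_) hr
      have h2 := hN i hi j hj w (hsub z hz hw)
      have h3 := hN i hi j hj z (hsub z hz (Metric.mem_ball_self hr))
      rw [dist_eq_norm] at h2 h3
      rw [Metric.mem_closedBall, dist_eq_norm]
      refine (norm_sub_le _ _).trans ?_
      linarith
    rw [fderiv_fun_sub (hdz i) (hdz j)] at h1
    rw [dist_eq_norm]
    have h4 : (ε * r / 2) / r = ε / 2 := by field_simp
    linarith
  have hlim : ∀ z ∈ Metric.ball c r, ∃ L, Tendsto (fun k => fderiv ℂ (f k) z) atTop (𝓝 L) :=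
    fun z hz => cauchySeq_tendsto_of_complete (hc.cauchySeq hz)
  choose! g' hg' using hlim
  have h5 := hc.tendstoUniformlyOn_of_tendsto hg'
  refine (hasFDerivAt_of_tendstoUniformlyOn Metric.isOpen_ball h5 (fun k z hz => ?_)
    (fun z hz => h.tendsto_at (hsub z hz (Metric.mem_ball_self hr)))
    (Metric.mem_ball_self hr)).differentiableAt
  exact ((hf k).differentiableAt (Metric.isOpen_ball.mem_nhds
    (hsub z hz (Metric.mem_ball_self hr)))).hasFDerivAt

lemma isOpen_tube (hΩ : IsOpen Ω) : IsOpen (tube Ω) :=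
  hΩ.preimage (by fun_prop : Continuous fun (z : Fin n → ℂ) j => (z j).im)

lemma convex_tube (hΩ : Convex ℝ Ω) : Convex ℝ (tube Ω) := by
  intro x hx y hy a b ha hb hab
  have := hΩ hx hy ha hb hab
  show (fun j => ((a • x + b • y) j).im) ∈ Ω
  convert this using 1
  funext j
  simp

/-- A mapping that is approximated by holomorphic mappings, uniformly on the subtubes, is
holomorphic. -/
lemma isHolomorphic_of_approx (hΩ : IsOpen Ω) {f : tube Ω → Fin m → ℂ}
    (h : ∀ Ω', RelCompact Ω' Ω → ∀ ε : ℝ, 0 < ε → ∃ G : tube Ω → Fin m → ℂ,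
      IsHolomorphic G ∧ ∀ z ∈ subtube Ω Ω', ∀ l, ‖G z l - f z l‖ ≤ ε) : IsHolomorphic f := by
  classical
  refine ⟨fun z => if hz : z ∈ tube Ω then f ⟨z, hz⟩ else 0, ?_, fun z => by simp⟩
  rw [differentiableOn_pi]
  intro l z₀ hz₀
  apply DifferentiableAt.differentiableWithinAt
  obtain ⟨r, hr, hball⟩ := Metric.isOpen_iff.1 hΩ _ hz₀
  set Ω' := Metric.ball (fun j => (z₀ j).im) (2 * (r / 4)) with hΩ'
  have hcl : closure Ω' ⊆ Metric.closedBall (fun j => (z₀ j).im) (2 * (r / 4)) :=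
    Metric.closure_ball_subset_closedBall
  have hrel : RelCompact Ω' Ω := by
    refine ⟨(isCompact_closedBall _ _).of_isClosed_subset isClosed_closure hcl, ?_⟩
    exact (hcl.trans (Metric.closedBall_subset_ball (by linarith))).trans hball
  have him : ∀ z ∈ Metric.ball z₀ (2 * (r / 4)), (fun j => (z j).im) ∈ Ω' := by
    intro z hz
    rw [Metric.mem_ball, dist_pi_lt_iff (by positivity)] at hz
    rw [hΩ', Metric.mem_ball, dist_pi_lt_iff (by positivity)]
    intro j
    refine lt_of_le_of_lt ?_ (hz j)
    rw [dist_eq_norm, dist_eq_norm, ← Complex.sub_im]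
    exact Complex.abs_im_le_norm _
  have htube : ∀ z ∈ Metric.ball z₀ (2 * (r / 4)), z ∈ tube Ω := fun z hz =>
    hrel.2 (subset_closure (him z hz))
  choose G hG hGf using fun k : ℕ => h Ω' hrel (1 / ((k : ℝ) + 1)) (by positivity)
  choose H hH hGH using hG
  refine differentiableAt_of_tendstoUniformlyOn_ball (f := fun k z => H k z l) (r := r / 4)
    (by positivity) (fun k => (differentiableOn_pi.1 (hH k) l).mono htube) ?_
  rw [Metric.tendstoUniformlyOn_iff]
  intro ε hε
  obtain ⟨N, hN⟩ := exists_nat_one_div_lt hε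
  filter_upwards [eventually_ge_atTop N] with k hk z hz
  rw [dist_comm, dist_eq_norm]
  simp only [htube z hz, dif_pos]
  rw [← hGH k ⟨z, htube z hz⟩]
  refine lt_of_le_of_lt (hGf k ⟨z, htube z hz⟩ (him z hz) l) (lt_of_le_of_lt ?_ hN)
  gcongr

/-- A holomorphic function on a tube that is invariant under real translations is constant. -/
lemma eq_of_translation_invariant (hΩ : IsOpen Ω) (hΩc : Convex ℝ Ω) {g : (Fin n → ℂ) → ℂ}
    (hg : DifferentiableOn ℂ g (tube Ω))
    (hinv : ∀ z ∈ tube Ω, ∀ t : Fin n → ℝ, g (fun j => z j + (t j : ℂ)) = g z)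
    {z w : Fin n → ℂ} (hz : z ∈ tube Ω) (hw : w ∈ tube Ω) : g z = g w := by
  refine (isOpen_tube hΩ).is_const_of_fderiv_eq_zero (convex_tube hΩc).isPreconnected hg ?_ hz hw
  intro z hz
  have hd := (hg.differentiableAt ((isOpen_tube hΩ).mem_nhds hz)).hasFDerivAt
  -- The derivative is complex linear and `ℂⁿ = ℝⁿ + iℝⁿ`, so it is enough that it vanishes on real
  -- vectors.
  have hreal : ∀ t : Fin n → ℝ, fderiv ℂ g z (fun j => (t j : ℂ)) = 0 := by
    intro t
    have h1 := (hd.restrictScalars ℝ).hasLineDerivAt fun j => (t j : ℂ)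
    have h2 : HasDerivAt (fun s : ℝ => g (z + s • fun j => (t j : ℂ))) 0 0 := by
      have : (fun s : ℝ => g (z + s • fun j => (t j : ℂ))) = fun _ => g z := by
        funext s
        rw [← hinv z hz fun j => s * t j]
        congr 1
        funext j
        simp
      rw [this]
      exact hasDerivAt_const _ _
    exact HasDerivAt.unique h1 h2
  ext1 v
  have hv : v = (fun j => ((v j).re : ℂ)) + Complex.I • fun j => ((v j).im : ℂ) := by
    funext j
    simp only [Pi.add_apply, Pi.smul_apply, smul_eq_mul]
    rw [mul_comm, Complex.re_add_im]
  rw [hv, map_add, map_smul, hreal, hreal]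
  simp

lemma HAP.continuous_translate (F : HAP Ω m) (z : tube Ω) (l : Fin m) :
    Continuous fun t => F.toFun (translate z t) l :=
  (continuous_apply l).comp (F.holomorphic.continuous.comp (AlmostPeriodic.continuous_translate z))

lemma subtube_singleton (z : tube Ω) : z ∈ subtube Ω {fun j => (z.1 j).im} := rfl

lemma exists_hasCoeff_translate (F : HAP Ω m) (l : Fin m) (lam : Fin n → ℝ) (z : tube Ω) :
    ∃ c, HasCoeff (fun t => F.toFun (translate z t) l) lam c := by
  refine exists_hasCoeff (F.continuous_translate z l) (fun ε hε => ?_) lam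
  obtain ⟨Λ, G, hG, -⟩ := exists_isApprox F (relCompact_singleton ⟨_, z.2⟩) hε
  exact ⟨Λ, fun lam => G lam z l, fun x => hG.approx z (subtube_singleton z) x l⟩

-- Taking means is a contraction. The coefficient of `F` at `z + s` is thus close to that of the
-- approximating sum, which is known explicitly: this yields both holomorphy in `z` and the
-- exponential law in `s`.
open Classical in
lemma IsApprox.norm_coeff_sub_le {F : HAP Ω m} {ε : ℝ} {Λ : Finset (Fin n → ℝ)}
    {G : (Fin n → ℝ) → tube Ω → Fin m → ℂ} (h : IsApprox F Ω' ε Λ G) {z : tube Ω}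
    (hz : z ∈ subtube Ω Ω') (s : Fin n → ℝ) {l : Fin m} {lam : Fin n → ℝ} {c : ℂ}
    (hc : HasCoeff (fun t => F.toFun (translate (translate z s) t) l) lam c) :
    ‖c - if lam ∈ Λ then G lam z l * expo lam (fun j => (s j : ℂ)) else 0‖ ≤ ε := by
  have h1 := hasCoeff_expSum Λ
    (fun mu => G mu z l * expo mu (fun j => (s j : ℂ))) (fun mu => mu) lam
  rw [Finset.sum_ite_eq'] at h1
  have hcont : Continuous fun x : Fin n → ℝ => ∑ mu ∈ Λ,
      (G mu z l * expo mu fun j => (s j : ℂ)) * expo mu fun j => (x j : ℂ) :=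
    continuous_finsetSum _ fun i _ => continuous_const.mul (continuous_expo_ofReal _)
  refine (hc.sub (F.continuous_translate _ l) hcont h1).norm_le
    fun x => ?_
  have h2 := h.approx z hz (s + x) l
  simp only [translate_translate, mul_assoc, ← expo_ofReal_add]
  exact h2

/-- The means over the real directions are multiples of exponentials. -/
theorem exists_hasCoeff_mul_expo (hΩ : IsOpen Ω) (hΩc : Convex ℝ Ω) (hΩne : Ω.Nonempty)
    (F : HAP Ω m) (l : Fin m) (lam : Fin n → ℝ) :
    ∃ a, ∀ z : tube Ω, HasCoeff (fun t => F.toFun (translate z t) l) lam (a * expo lam z.1) := by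
  classical
  choose c hc using fun (l : Fin m) (z : tube Ω) => exists_hasCoeff_translate F l lam z
  have hhol : IsHolomorphic fun z l => c l z := by
    refine isHolomorphic_of_approx hΩ fun Ω' hΩ' ε hε => ?_
    obtain ⟨Λ, G, hG, hGh⟩ := exists_isApprox F hΩ' hε
    refine ⟨if lam ∈ Λ then G lam else fun _ _ => 0, ?_, fun z hz l => ?_⟩
    · split_ifs
      · exact hGh lam
      · exact ⟨fun _ _ => 0, differentiableOn_const _, fun _ => rfl⟩
    · have h1 := hG.norm_coeff_sub_le hz 0 (lam := lam) (l := l) (c := c l z)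
        (by rw [translate_zero]; exact hc l z)
      rw [norm_sub_rev]
      split_ifs at h1 ⊢ <;> simpa [expo_zero] using h1
  -- Both sides are within `ε / 2` of the same coefficient of an approximating sum.
  have hequi : ∀ z s, c l (translate z s) = c l z * expo lam fun j => (s j : ℂ) := by
    intro z s
    refine eq_of_forall_dist_le fun ε hε => ?_
    obtain ⟨Λ, G, hG, -⟩ := exists_isApprox F (relCompact_singleton ⟨_, z.2⟩) (half_pos hε)
    have h1 := hG.norm_coeff_sub_le (subtube_singleton z) s (hc l (translate z s))
    have h2 := hG.norm_coeff_sub_le (subtube_singleton z) 0 (lam := lam) (l := l) (c := c l z)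
      (by rw [translate_zero]; exact hc l z)
    have h3 : ‖c l z * expo lam (fun j => (s j : ℂ)) -
        if lam ∈ Λ then G lam z l * expo lam (fun j => (s j : ℂ)) else 0‖ ≤ ε / 2 := by
      have h4 : (c l z * expo lam (fun j => (s j : ℂ)) -
          if lam ∈ Λ then G lam z l * expo lam (fun j => (s j : ℂ)) else 0) =
          (c l z - if lam ∈ Λ then G lam z l * expo lam (fun j => ((0 : Fin n → ℝ) j : ℂ)) else 0) *
            expo lam (fun j => (s j : ℂ)) := by
        split_ifs
        · simp [expo_zero, sub_mul]
        · simp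
      rw [h4, norm_mul, norm_expo_ofReal, mul_one]
      exact h2
    rw [dist_eq_norm]
    rw [norm_sub_rev] at h3
    refine (norm_sub_le_norm_sub_add_norm_sub _
      (if lam ∈ Λ then G lam z l * expo lam (fun j => (s j : ℂ)) else 0) _).trans ?_
    linarith
  obtain ⟨y, hy⟩ := hΩne
  let z₀ : tube Ω := tubePoint 0 ⟨y, hy⟩
  obtain ⟨H, hH, hcH⟩ := hhol
  have hcH' : ∀ z : tube Ω, c l z = H z.1 l := fun z => congrFun (hcH z) l
  refine ⟨H z₀.1 l * expo (-lam) z₀.1, fun z => ?_⟩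
  -- The function `c(z) e^{-i⟨z, λ⟩}` is holomorphic and invariant under real translations, hence
  -- constant. So the Bohr transform does not depend on `y`.
  have h1 : H z₀.1 l * expo (-lam) z₀.1 = H z.1 l * expo (-lam) z.1 := by
    refine eq_of_translation_invariant hΩ hΩc (g := fun z => H z l * expo (-lam) z)
      ((differentiableOn_pi.1 hH l).mul ?_) (fun z hz t => ?_) z₀.2 z.2
    · apply Differentiable.differentiableOn
      unfold expo pairing
      fun_prop
    · have h2 := hequi ⟨z, hz⟩ t
      rw [hcH', hcH'] at h2
      have h3 : H (fun j => z j + (t j : ℂ)) l = H z l * expo lam fun j => (t j : ℂ) := h2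
      rw [h3, expo_add]
      have h4 := expo_neg_mul_expo lam fun j => (t j : ℂ)
      linear_combination H z l * expo (-lam) z * h4
  rw [h1, mul_assoc, expo_neg_mul_expo, mul_one, ← hcH']
  exact hc l z

/-- The Bohr transform gives the means over the real directions. -/
theorem hasCoeff_bohr (hΩ : IsOpen Ω) (hΩc : Convex ℝ Ω) (hΩne : Ω.Nonempty)
    (F : HAP Ω m) (l : Fin m) (lam : Fin n → ℝ) (z : tube Ω) :
    HasCoeff (fun t => F.toFun (translate z t) l) lam (bohr F l lam * expo lam z.1) := by
  obtain ⟨a, ha⟩ := exists_hasCoeff_mul_expo hΩ hΩc hΩne F l lam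
  have htp : ∀ x (y : Ω), tubePoint x y = translate (tubePoint 0 y) x := by
    intro x y
    apply Subtype.ext
    funext j
    simp [tubePoint, translate, add_comm]
  have hmean : ∀ y : Ω, Tendsto (fun s : ℝ => (1 / (2 * (s : ℂ)) ^ n) *
      ∫ x in {x : Fin n → ℝ | ∀ j, |x j| < s},
        Complex.exp (-Complex.I * pairing (tubePoint x y).1 lam) * F.toFun (tubePoint x y) l)
      atTop (𝓝 a) := by
    intro y
    have h1 : Tendsto _ atTop _ := (ha (tubePoint 0 y)).const_mul (expo (-lam) (tubePoint 0 y).1)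
    rw [mul_left_comm, expo_neg_mul_expo, mul_one] at h1
    refine h1.congr fun s => ?_
    rw [← avg_const_mul]
    unfold avg cube
    congr 2
    funext x
    beta_reduce
    rw [← mul_assoc, htp x y, ← expo_translate]
    congr 1
    unfold expo pairing
    congr 1
    simp
  have hex : ∃ a : ℂ, ∀ y : Ω, Tendsto (fun s : ℝ => (1 / (2 * (s : ℂ)) ^ n) *
      ∫ x in {x : Fin n → ℝ | ∀ j, |x j| < s},
        Complex.exp (-Complex.I * pairing (tubePoint x y).1 lam) * F.toFun (tubePoint x y) l)
      atTop (𝓝 a) := ⟨a, hmean⟩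
  -- Since `a` has the defining property, so does the value chosen by `bohr`; a point `y` of `Ω` and
  -- uniqueness of limits identify the two.
  have h2 := Classical.epsilon_spec hex
  obtain ⟨y, hy⟩ := hΩne
  have h3 : bohr F l lam = a := tendsto_nhds_unique (h2 ⟨y, hy⟩) (hmean ⟨y, hy⟩)
  rw [h3]
  exact ha z

/-! ### Countability of the spectrum and bases of the frequency space -/

lemma expo_ne_zero (lam : Fin n → ℝ) (z : Fin n → ℂ) : expo lam z ≠ 0 := Complex.exp_ne_zero _

/-- A frequency absent from all the approximating sums, with errors `1 / (k + 1)`, has arbitrarily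
small coefficient, so the spectrum lies in a countable union of finite sets. -/
lemma countable_spec (hΩ : IsOpen Ω) (hΩc : Convex ℝ Ω) (hΩne : Ω.Nonempty)
    (F : HAP Ω m) (l : Fin m) : (spec F l).Countable := by
  classical
  obtain ⟨y, hy⟩ := hΩne
  let z : tube Ω := tubePoint 0 ⟨y, hy⟩
  choose Λ G hG _ using fun k : ℕ => exists_isApprox F (relCompact_singleton ⟨_, z.2⟩)
    (ε := 1 / ((k : ℝ) + 1)) (by positivity)
  refine (Set.countable_iUnion fun k => (Λ k).countable_toSet).mono fun lam hlam => ?_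
  by_contra hcon
  simp only [Set.mem_iUnion, not_exists, Finset.mem_coe] at hcon
  have h1 : bohr F l lam * expo lam z.1 = 0 := by
    refine norm_le_zero_iff.1 (le_of_forall_pos_le_add fun ε hε => ?_)
    obtain ⟨k, hk⟩ := exists_nat_one_div_lt hε
    have h2 := (hG k).norm_coeff_sub_le (subtube_singleton z) 0 (lam := lam) (l := l)
      (c := bohr F l lam * expo lam z.1)
      (by rw [translate_zero]; exact hasCoeff_bohr hΩ hΩc ⟨y, hy⟩ F l lam z)
    rw [if_neg (hcon k), sub_zero] at h2
    linarith
  exact hlam ((mul_eq_zero.1 h1).resolve_right (expo_ne_zero _ _))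

lemma exists_equiv_of_countable {α : Type*} (b : Set α) (hb : b.Countable) :
    ∃ d : ℕ∞, Nonempty ({r : ℕ // (r : ℕ∞) < d} ≃ b) := by
  have := hb.to_subtype
  rcases finite_or_infinite b with hf | hi
  · refine ⟨(Nat.card b : ℕ∞), ⟨Equiv.trans ?_ (Finite.equivFin b).symm⟩⟩
    exact (Equiv.subtypeEquivRight fun r => Nat.cast_lt).trans Fin.equivSubtype.symm
  · obtain ⟨e⟩ := nonempty_denumerable b
    exact ⟨⊤, ⟨(Equiv.subtypeUnivEquiv fun r => ENat.natCast_lt_top r).trans (Denumerable.eqv b).symm⟩⟩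

/-- A basis can be extracted from `S` itself, so it is countable and can be enumerated. -/
lemma exists_isBasisSeq_span (S : Set (Fin n → ℝ)) (hS : S.Countable) :
    ∃ (d : ℕ∞) (ω : ℕ → Fin n → ℝ), IsBasisSeq (Submodule.span ℚ S) d ω := by
  classical
  obtain ⟨b, hbS, hspan, hli⟩ := exists_linearIndependent ℚ S
  obtain ⟨d, ⟨e⟩⟩ := exists_equiv_of_countable b (hS.mono hbS)
  have hω : ∀ r : {r : ℕ // (r : ℕ∞) < d},
      (fun r : ℕ => if h : (r : ℕ∞) < d then (e ⟨r, h⟩ : Fin n → ℝ) else 0) r = e r := by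
    rintro ⟨r, hr⟩
    simp [hr]
  refine ⟨d, fun r => if h : (r : ℕ∞) < d then (e ⟨r, h⟩ : Fin n → ℝ) else 0, ?_, ?_⟩
  · simp only [hω]
    exact hli.comp e e.injective
  · rw [← hspan]
    congr 1
    ext x
    constructor
    · rintro ⟨r, hr, rfl⟩
      rw [hω ⟨r, hr⟩]
      exact (e _).2
    · intro hx
      refine ⟨e.symm ⟨x, hx⟩, (e.symm ⟨x, hx⟩).2, ?_⟩
      rw [hω, Equiv.apply_symm_apply]

lemma freqSpace_eq_span (F : HAP Ω m) : freqSpace F = Submodule.span ℚ (⋃ l, spec F l) := by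
  refine le_antisymm (Submodule.span_le.2 ?_) (Submodule.span_mono AddSubgroup.subset_closure)
  have : freqModule F ≤ (Submodule.span ℚ (⋃ l, spec F l)).toAddSubgroup :=
    (AddSubgroup.closure_le _).2 Submodule.subset_span
  exact this

lemma mem_freqSpace {F : HAP Ω m} {l : Fin m} {lam : Fin n → ℝ} (h : bohr F l lam ≠ 0) :
    lam ∈ freqSpace F := by
  rw [freqSpace_eq_span]
  exact Submodule.subset_span (Set.mem_iUnion.2 ⟨l, h⟩)

theorem exists_isBasisSeq (hΩ : IsOpen Ω) (hΩc : Convex ℝ Ω) (hΩne : Ω.Nonempty)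
    (F : HAP Ω m) : ∃ (d : ℕ∞) (ω : ℕ → Fin n → ℝ), IsBasisSeq (freqSpace F) d ω := by
  rw [freqSpace_eq_span]
  exact exists_isBasisSeq_span _ (Set.countable_iUnion fun l => countable_spec hΩ hΩc hΩne F l)

/-! ### Fejér kernels and convergence of the Bochner-Fejér approximations -/

section Fejer

/-- The Fejér kernel is the square of a modulus. -/
lemma sum_fejer_eq_normSq (w : ℂ) (hw : ‖w‖ = 1) (N : ℕ) :
    ∑ ν ∈ Finset.Icc (-(N : ℤ)) N, ((N : ℂ) - ((|ν| : ℤ) : ℂ)) * w ^ ν =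
      ((Complex.normSq (∑ k ∈ Finset.range N, w ^ k) : ℝ) : ℂ) := by
  have hw0 : w ≠ 0 := by rintro rfl; simp at hw
  have hconj : (starRingEnd ℂ) w = w⁻¹ := by
    rw [Complex.inv_def, Complex.normSq_eq_norm_sq, hw]; simp
  have hIcc : ∀ (N : ℕ) (f : ℤ → ℂ), ∑ ν ∈ Finset.Icc (-((N + 1 : ℕ) : ℤ)) (N + 1 : ℕ), f ν =
      ∑ ν ∈ Finset.Icc (-(N : ℤ)) N, f ν + (f (N + 1) + f (-(N + 1))) := by
    intro N f
    have h : Finset.Icc (-((N + 1 : ℕ) : ℤ)) (N + 1 : ℕ) =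
        insert ((N : ℤ) + 1) (insert (-((N : ℤ) + 1)) (Finset.Icc (-(N : ℤ)) N)) := by
      ext x; simp only [Finset.mem_Icc, Finset.mem_insert]; omega
    rw [h, Finset.sum_insert, Finset.sum_insert]
    · ring
    · simp only [Finset.mem_Icc]; omega
    · simp only [Finset.mem_Icc, Finset.mem_insert]; omega
  have hT : ∀ N : ℕ, ∑ ν ∈ Finset.Icc (-(N : ℤ)) N, w ^ ν =
      1 + ∑ k ∈ Finset.range N, w ^ (k + 1) + ∑ k ∈ Finset.range N, w⁻¹ ^ (k + 1) := by
    intro N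
    induction N with
    | zero => simp
    | succ N ih =>
      rw [hIcc, ih, Finset.sum_range_succ, Finset.sum_range_succ, zpow_neg]
      have : w ^ ((N : ℤ) + 1) = w ^ (N + 1) := by exact_mod_cast zpow_natCast w (N + 1)
      rw [this, inv_pow]
      ring
  have hrefl : ∀ (v : ℂ), v ≠ 0 → ∀ N : ℕ, v ^ N * ∑ k ∈ Finset.range N, v⁻¹ ^ k =
      ∑ k ∈ Finset.range N, v ^ (k + 1) := by
    intro v hv N
    rw [← Finset.sum_range_reflect, Finset.mul_sum]
    refine Finset.sum_congr rfl fun k hk => ?_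
    have hk' := Finset.mem_range.1 hk
    have : N = (N - 1 - k) + (k + 1) := by omega
    rw [inv_pow]
    conv_lhs => rw [this, pow_add]
    have h2 : N - 1 - k + (k + 1) - 1 - k = N - 1 - k := by omega
    rw [h2]
    field_simp
  induction N with
  | zero => simp
  | succ N ih =>
    -- Passing from `N` to `N + 1` adds the Dirichlet sum on the left. On the right, adding `w ^ N`
    -- to the geometric sum contributes 1 and two cross terms, which are the two halves of that sum.
    have h1 : ∑ ν ∈ Finset.Icc (-((N + 1 : ℕ) : ℤ)) (N + 1 : ℕ),
        (((N + 1 : ℕ) : ℂ) - ((|ν| : ℤ) : ℂ)) * w ^ ν =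
        ∑ ν ∈ Finset.Icc (-(N : ℤ)) N, ((N : ℂ) - ((|ν| : ℤ) : ℂ)) * w ^ ν +
          ∑ ν ∈ Finset.Icc (-(N : ℤ)) N, w ^ ν := by
      rw [hIcc, ← Finset.sum_add_distrib, abs_neg,
        abs_of_nonneg (by positivity : (0 : ℤ) ≤ (N : ℤ) + 1)]
      push_cast
      rw [sub_self, zero_mul, zero_mul, add_zero, add_zero]
      exact Finset.sum_congr rfl fun ν _ => by ring
    rw [h1, ih, hT, Complex.normSq_eq_conj_mul_self, Complex.normSq_eq_conj_mul_self,
      Finset.sum_range_succ, map_add, map_sum]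
    simp only [map_pow, hconj]
    have h2 := hrefl w hw0 N
    have h3 := hrefl w⁻¹ (inv_ne_zero hw0) N
    rw [inv_inv] at h3
    have h4 : w⁻¹ ^ N * w ^ N = 1 := by rw [← mul_pow, inv_mul_cancel₀ hw0, one_pow]
    linear_combination -h2 - h3 - h4

lemma exists_nonneg_fejer (w : ℂ) (hw : ‖w‖ = 1) (N : ℕ) (hN : 0 < N) :
    ∃ r : ℝ, 0 ≤ r ∧
      ∑ ν ∈ Finset.Icc (-(N : ℤ)) N, ((1 - |(ν : ℝ)| / (N : ℝ) : ℝ) : ℂ) * w ^ ν = r := by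
  refine ⟨Complex.normSq (∑ k ∈ Finset.range N, w ^ k) / N,
    div_nonneg (Complex.normSq_nonneg _) (Nat.cast_nonneg N), ?_⟩
  have hN' : (N : ℂ) ≠ 0 := by exact_mod_cast hN.ne'
  rw [Complex.ofReal_div, ← sum_fejer_eq_normSq w hw N, Finset.sum_div]
  refine Finset.sum_congr rfl fun ν _ => ?_
  have hν : ((|ν| : ℤ) : ℂ) = ((|(ν : ℝ)| : ℝ) : ℂ) := by
    rw [← Int.cast_abs, Complex.ofReal_intCast]
  rw [hν, Complex.ofReal_sub, Complex.ofReal_div, Complex.ofReal_one, Complex.ofReal_natCast]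
  field_simp

end Fejer

/-- The index set of the Bochner-Fejér kernels. -/
def fejerBox (j k : ℕ) : Finset (Fin k → ℤ) :=
  Fintype.piFinset fun _ : Fin k =>
    Finset.Icc (-((j.factorial : ℤ) ^ 2)) ((j.factorial : ℤ) ^ 2)

lemma fejerFreq_sub (ω : ℕ → Fin n → ℝ) (j : ℕ) {k : ℕ} (ν ν' : Fin k → ℤ) :
    fejerFreq ω j (ν - ν') = fejerFreq ω j ν - fejerFreq ω j ν' := by
  unfold fejerFreq
  rw [← Finset.sum_sub_distrib]
  refine Finset.sum_congr rfl fun r _ => ?_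
  rw [← sub_smul, Pi.sub_apply]
  push_cast
  rw [sub_div]

lemma fejerFreq_eq_rat (ω : ℕ → Fin n → ℝ) (j : ℕ) {k : ℕ} (ν : Fin k → ℤ) :
    fejerFreq ω j ν = ∑ r : Fin k, ((ν r : ℚ) / (j.factorial : ℚ)) • ω r := by
  unfold fejerFreq
  refine Finset.sum_congr rfl fun r _ => ?_
  funext i
  rw [Pi.smul_apply, Pi.smul_apply, Rat.smul_def]
  push_cast
  rfl

/-- This is where rational independence enters: no two index tuples share a frequency, so in
particular only `ν = 0` contributes to the mean of the kernel. -/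
lemma fejerFreq_injective {ω : ℕ → Fin n → ℝ} {k : ℕ}
    (hω : LinearIndependent ℚ fun r : Fin k => ω r) (j : ℕ) :
    Function.Injective fun ν : Fin k → ℤ => fejerFreq ω j ν := by
  intro ν ν' h
  have h1 : fejerFreq ω j (ν - ν') = 0 := by rw [fejerFreq_sub]; exact sub_eq_zero.2 h
  rw [fejerFreq_eq_rat] at h1
  funext r
  have h2 := Fintype.linearIndependent_iff.1 hω _ h1 r
  have h3 : (j.factorial : ℚ) ≠ 0 := by exact_mod_cast j.factorial_ne_zero
  rw [div_eq_zero_iff, or_iff_left h3] at h2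
  have h4 : (ν - ν') r = 0 := by exact_mod_cast h2
  exact sub_eq_zero.1 h4

lemma fejerFreq_zero (ω : ℕ → Fin n → ℝ) (j k : ℕ) : fejerFreq ω j (0 : Fin k → ℤ) = 0 := by
  simp [fejerFreq]

lemma fejerMult_zero (j k : ℕ) : fejerMult j (0 : Fin k → ℤ) = 1 := by
  simp [fejerMult]

lemma zero_mem_fejerBox (j k : ℕ) : (0 : Fin k → ℤ) ∈ fejerBox j k := by
  simp only [fejerBox, Fintype.mem_piFinset, Finset.mem_Icc, Pi.zero_apply]
  intro _
  constructor
  · rw [neg_nonpos]; positivity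
  · positivity

/-- The Bochner-Fejér kernel. -/
def fejerKernel (ω : ℕ → Fin n → ℝ) (j k : ℕ) (t : Fin n → ℝ) : ℂ :=
  ∑ ν ∈ fejerBox j k, (fejerMult j ν : ℂ) * expo (-fejerFreq ω j ν) fun i => (t i : ℂ)

lemma expo_sum_smul {ι : Type*} (s : Finset ι) (c : ι → ℝ) (μ : ι → Fin n → ℝ)
    (z : Fin n → ℂ) : expo (∑ r ∈ s, c r • μ r) z = ∏ r ∈ s, expo (c r • μ r) z := by
  classical
  induction s using Finset.induction_on with
  | empty => simp [expo, pairing]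
  | insert i s hi ih => rw [Finset.sum_insert hi, Finset.prod_insert hi, expo_add_freq, ih]

lemma expo_intCast_div_smul (a : ℤ) (b : ℝ) (mu : Fin n → ℝ) (z : Fin n → ℂ) :
    expo (((a : ℝ) / b) • mu) z = expo ((1 / b) • mu) z ^ a := by
  unfold expo pairing
  rw [← Complex.exp_int_mul]
  congr 1
  simp only [Pi.smul_apply, smul_eq_mul, Finset.mul_sum]
  refine Finset.sum_congr rfl fun i _ => ?_
  push_cast
  ring

/-- The kernel is a product of one-dimensional Fejér kernels of order `(j!)²`, evaluated at the
numbers `e^{-i⟨t, ω_r / j!⟩}`. -/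
lemma exists_nonneg_fejerKernel (ω : ℕ → Fin n → ℝ) (j k : ℕ) (t : Fin n → ℝ) :
    ∃ r : ℝ, 0 ≤ r ∧ fejerKernel ω j k t = r := by
  have hN : 0 < j.factorial ^ 2 := pow_pos j.factorial_pos 2
  choose f hf0 hf using fun r : Fin k => exists_nonneg_fejer
    (expo ((1 / (j.factorial : ℝ)) • ω r) fun i => ((-t) i : ℂ)) (norm_expo_ofReal _ (-t)) _ hN
  refine ⟨∏ r, f r, Finset.prod_nonneg fun r _ => hf0 r, ?_⟩
  rw [Complex.ofReal_prod, Finset.prod_congr rfl fun r _ => (hf r).symm, Finset.prod_univ_sum]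
  unfold fejerKernel fejerBox
  push_cast
  refine Finset.sum_congr rfl fun ν _ => ?_
  have h1 : expo (-fejerFreq ω j ν) (fun i => (t i : ℂ)) =
      expo (fejerFreq ω j ν) (fun i => ((-t) i : ℂ)) := by
    unfold expo pairing
    congr 2
    exact Finset.sum_congr rfl fun i _ => by simp
  rw [h1, fejerMult, fejerFreq, expo_sum_smul, Complex.ofReal_prod, ← Finset.prod_mul_distrib]
  refine Finset.prod_congr rfl fun r _ => ?_
  rw [expo_intCast_div_smul]
  push_cast
  rfl

lemma continuous_fejerKernel (ω : ℕ → Fin n → ℝ) (j k : ℕ) :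
    Continuous (fejerKernel ω j k) :=
  continuous_finsetSum _ fun _ _ => continuous_const.mul (continuous_expo_ofReal _)

lemma tendsto_avg_fejerKernel {ω : ℕ → Fin n → ℝ} {k : ℕ}
    (hω : LinearIndependent ℚ fun r : Fin k => ω r) (j : ℕ) :
    Tendsto (fun s => avg s (fejerKernel ω j k)) atTop (𝓝 1) := by
  classical
  have h := hasCoeff_expSum (fejerBox j k) (fun ν => (fejerMult j ν : ℂ))
    (fun ν => -fejerFreq ω j ν) (0 : Fin n → ℝ)
  rw [Finset.sum_eq_single_of_mem 0 (zero_mem_fejerBox j k), fejerFreq_zero, neg_zero,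
    if_pos rfl, fejerMult_zero, Complex.ofReal_one] at h
  · refine h.congr fun s => ?_
    congr 1
    funext x
    simp [fejerKernel, expo, pairing]
  · intro ν _ hν
    rw [if_neg]
    intro h0
    refine hν (fejerFreq_injective hω j ?_)
    show fejerFreq ω j ν = fejerFreq ω j 0
    rw [fejerFreq_zero, neg_eq_zero.1 h0]

/-- The Bochner-Fejér means are contractions in the supremum norm. -/
lemma norm_fejer_sum_le {ω : ℕ → Fin n → ℝ} {k : ℕ}
    (hω : LinearIndependent ℚ fun r : Fin k => ω r) (j : ℕ) {h : (Fin n → ℝ) → ℂ}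
    (hh : Continuous h) {M : ℝ} (hM : ∀ x, ‖h x‖ ≤ M) {a : (Fin k → ℤ) → ℂ}
    (ha : ∀ ν ∈ fejerBox j k, HasCoeff h (fejerFreq ω j ν) (a ν)) :
    ‖∑ ν ∈ fejerBox j k, (fejerMult j ν : ℂ) * a ν‖ ≤ M := by
  -- The Bochner-Fejér sum is the mean of kernel times function. As the kernel is non-negative with
  -- mean tending to 1, this mean is bounded by `M`.
  have h1 : Tendsto (fun s => avg s fun x => fejerKernel ω j k x * h x) atTop
      (𝓝 (∑ ν ∈ fejerBox j k, (fejerMult j ν : ℂ) * a ν)) := by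
    refine (tendsto_finsetSum (fejerBox j k)
      fun ν hν => (ha ν hν).const_mul (fejerMult j ν : ℂ)).congr fun s => ?_
    simp only [← avg_const_mul]
    rw [← avg_sum _ fun ν _ => (continuous_expo_mul _ hh).const_mul _]
    congr 1
    funext x
    rw [fejerKernel, Finset.sum_mul]
    exact Finset.sum_congr rfl fun ν _ => by ring
  have h2 := (tendsto_avg_fejerKernel hω j).norm.const_mul M
  rw [norm_one, mul_one] at h2
  refine le_of_tendsto_of_tendsto h1.norm h2 (Eventually.of_forall fun s => ?_)
  refine norm_avg_mul_le (continuous_fejerKernel ω j k) (fun x => ?_) hM s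
  obtain ⟨r, hr0, hr⟩ := exists_nonneg_fejerKernel ω j k x
  rw [hr, Complex.norm_real, Real.norm_of_nonneg hr0]

open Classical in
/-- The weight of the frequency `lam` in the Bochner-Fejér means. -/
def fejerWeight (ω : ℕ → Fin n → ℝ) (j k : ℕ) (lam : Fin n → ℝ) : ℝ :=
  ∑ ν ∈ fejerBox j k, if lam = fejerFreq ω j ν then fejerMult j ν else 0

/-- The contraction property applied to `h` minus the exponential sum: on a single exponential, the
means merely multiply by its weight. -/
lemma norm_fejer_sum_sub_le {ω : ℕ → Fin n → ℝ} {k : ℕ}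
    (hω : LinearIndependent ℚ fun r : Fin k => ω r) (j : ℕ) {h : (Fin n → ℝ) → ℂ}
    (hh : Continuous h) {a : (Fin k → ℤ) → ℂ}
    (ha : ∀ ν ∈ fejerBox j k, HasCoeff h (fejerFreq ω j ν) (a ν)) {ε : ℝ}
    {Λ : Finset (Fin n → ℝ)} {c : (Fin n → ℝ) → ℂ}
    (hc : ∀ x, ‖h x - ∑ lam ∈ Λ, c lam * expo lam fun i => (x i : ℂ)‖ ≤ ε) :
    ‖∑ ν ∈ fejerBox j k, (fejerMult j ν : ℂ) * a ν -
      ∑ lam ∈ Λ, c lam * (fejerWeight ω j k lam : ℂ)‖ ≤ ε := by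
  classical
  have hcont : Continuous fun x : Fin n → ℝ => ∑ lam ∈ Λ, c lam * expo lam fun i => (x i : ℂ) :=
    continuous_finsetSum _ fun i _ => continuous_const.mul (continuous_expo_ofReal _)
  have h1 := norm_fejer_sum_le hω j (hh.sub hcont) hc fun ν hν =>
    (ha ν hν).sub hh hcont (hasCoeff_expSum Λ c (fun mu => mu) (fejerFreq ω j ν))
  convert h1 using 2
  simp only [mul_sub, Finset.sum_sub_distrib]
  congr 1
  simp only [fejerWeight, Complex.ofReal_sum, Finset.mul_sum]
  rw [Finset.sum_comm]
  refine Finset.sum_congr rfl fun ν _ => Finset.sum_congr rfl fun lam _ => ?_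
  split_ifs <;> simp [mul_comm]

lemma lt_numTerms_iff (d : ℕ∞) (j r : ℕ) : r < numTerms d j ↔ r < j ∧ (r : ℕ∞) < d := by
  unfold numTerms
  induction d using ENat.recTopCoe with
  | top => simp
  | coe d =>
    have : min (j : ℕ∞) (d : ℕ∞) = ((min j d : ℕ) : ℕ∞) := (Nat.mono_cast.map_min).symm
    rw [this, ENat.toNat_natCast, lt_min_iff, Nat.cast_lt]

lemma IsBasisSeq.linearIndependent {V : Submodule ℚ (Fin n → ℝ)} {d : ℕ∞} {ω : ℕ → Fin n → ℝ}
    (h : IsBasisSeq V d ω) (j : ℕ) :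
    LinearIndependent ℚ fun r : Fin (numTerms d j) => ω r := by
  refine h.1.comp (fun r : Fin (numTerms d j) =>
    (⟨r, ((lt_numTerms_iff d j r).1 r.2).2⟩ : {r : ℕ // (r : ℕ∞) < d})) fun r s hrs => ?_
  exact Fin.ext (congrArg (fun x : {r : ℕ // (r : ℕ∞) < d} => (x : ℕ)) hrs)

/-- The weights of the Bochner-Fejér means tend to one. -/
lemma tendsto_fejerWeight {V : Submodule ℚ (Fin n → ℝ)} {d : ℕ∞} {ω : ℕ → Fin n → ℝ}
    (h : IsBasisSeq V d ω) {lam : Fin n → ℝ} (hlam : lam ∈ V) :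
    Tendsto (fun j => fejerWeight ω j (numTerms d j) lam) atTop (𝓝 1) := by
  classical
  rw [← h.2, Finsupp.mem_span_image_iff_linearCombination] at hlam
  obtain ⟨q, hq, hlam⟩ := hlam
  rw [Finsupp.linearCombination_apply, Finsupp.sum] at hlam
  have hfact : Tendsto (fun j : ℕ => (j.factorial : ℝ)) atTop atTop :=
    tendsto_natCast_atTop_atTop.comp (tendsto_atTop_mono Nat.self_le_factorial tendsto_id)
  have hlim : Tendsto (fun j : ℕ => ∏ r ∈ q.support, (1 - |(q r : ℝ)| / (j.factorial : ℝ)))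
      atTop (𝓝 1) := by
    have : Tendsto (fun j : ℕ => ∏ r ∈ q.support, (1 - |(q r : ℝ)| / (j.factorial : ℝ)))
        atTop (𝓝 (∏ r ∈ q.support, (1 - 0))) :=
      tendsto_finsetProd _ fun r _ => tendsto_const_nhds.sub (tendsto_const_nhds.div_atTop hfact)
    simpa using this
  refine hlim.congr' ?_
  -- The role of the factorials: for large `j` all coordinates `q r` have denominators dividing `j!`
  -- and modulus at most `j!`, so `ν_r = q_r j!` is an integer with `|ν_r| ≤ (j!)²`. The weight is
  -- then `∏ (1 - |q_r| / j!)`.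
  have hlarge : ∀ᶠ j : ℕ in atTop, ∀ r ∈ q.support,
      r < j ∧ (q r).den ∣ j.factorial ∧ |q r| ≤ (j.factorial : ℚ) := by
    rw [Finset.eventually_all]
    intro r _
    filter_upwards [eventually_gt_atTop r, eventually_ge_atTop (q r).den,
      eventually_ge_atTop ⌈|q r|⌉₊] with j h1 h2 h3
    refine ⟨h1, Nat.dvd_factorial (q r).pos h2, (Nat.le_ceil _).trans ?_⟩
    exact_mod_cast h3.trans (Nat.self_le_factorial j)
  filter_upwards [hlarge] with j hj
  set k := numTerms d j with hk
  have hfac : (j.factorial : ℚ) ≠ 0 := by exact_mod_cast j.factorial_ne_zero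
  have hsupp : q.support ⊆ Finset.range k := by
    intro r hr
    rw [Finset.mem_range, hk, lt_numTerms_iff]
    exact ⟨(hj r hr).1, hq hr⟩
  have hint : ∀ r : ℕ, ∃ a : ℤ, (a : ℚ) = q r * j.factorial := by
    intro r
    by_cases hr : r ∈ q.support
    · obtain ⟨b, hb⟩ := (hj r hr).2.1
      refine ⟨(q r).num * b, ?_⟩
      rw [hb]
      push_cast
      rw [← mul_assoc, Rat.mul_den_eq_num]
    · exact ⟨0, by simp [Finsupp.notMem_support_iff.1 hr]⟩
  choose a ha using hint
  have hdiv : ∀ r : ℕ, (a r : ℚ) / j.factorial = q r := fun r => by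
    rw [ha, mul_div_assoc, div_self hfac, mul_one]
  have hfreq : fejerFreq ω j (fun r : Fin k => a r) = lam := by
    rw [fejerFreq_eq_rat]
    simp only [hdiv]
    rw [Fin.sum_univ_eq_sum_range (fun r => q r • ω r) k, ← hlam]
    symm
    refine Finset.sum_subset hsupp fun r _ hr => ?_
    rw [Finsupp.notMem_support_iff.1 hr, zero_smul]
  have hbox : (fun r : Fin k => a r) ∈ fejerBox j k := by
    simp only [fejerBox, Fintype.mem_piFinset, Finset.mem_Icc, ← abs_le]
    intro r
    have h1 : |(a r : ℚ)| ≤ (j.factorial : ℚ) ^ 2 := by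
      rw [ha, abs_mul, Nat.abs_cast, sq]
      refine mul_le_mul_of_nonneg_right ?_ (Nat.cast_nonneg _)
      by_cases hr : (r : ℕ) ∈ q.support
      · exact (hj r hr).2.2
      · rw [Finsupp.notMem_support_iff.1 hr]; simp
    exact_mod_cast h1
  rw [fejerWeight, Finset.sum_eq_single_of_mem _ hbox, if_pos hfreq.symm, fejerMult,
    Fin.prod_univ_eq_prod_range (fun r => 1 - |(a r : ℝ)| / (j.factorial : ℝ) ^ 2) k]
  · symm
    rw [← Finset.prod_subset hsupp]
    · refine Finset.prod_congr rfl fun r _ => ?_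
      have h1 : (a r : ℝ) = q r * j.factorial := by exact_mod_cast ha r
      have h2 : (j.factorial : ℝ) ≠ 0 := by exact_mod_cast j.factorial_ne_zero
      rw [h1, abs_mul, Nat.abs_cast]
      field_simp
    · intro r _ hr
      have h1 : (a r : ℚ) = 0 := by rw [ha, Finsupp.notMem_support_iff.1 hr, zero_mul]
      have h2 : a r = 0 := by exact_mod_cast h1
      simp [h2]
  · intro ν _ hν
    rw [if_neg]
    intro h1
    exact hν (fejerFreq_injective (h.linearIndependent j) j (h1.symm.trans hfreq.symm))

lemma bochnerFejer_apply (d : ℕ∞) (ω : ℕ → Fin n → ℝ) (j : ℕ) (F : HAP Ω m) (z : tube Ω)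
    (l : Fin m) : (bochnerFejer d ω j F).toFun z l =
      ∑ ν ∈ fejerBox j (numTerms d j), (fejerMult j ν : ℂ) * bohr F l (fejerFreq ω j ν) *
        expo (fejerFreq ω j ν) z.1 := rfl

/-- An approximation with frequencies in `V` forces the Bochner-Fejér approximations for a basis of
`V` to be close to the mapping. -/
lemma IsApprox.eventually_bochnerFejer (hΩ : IsOpen Ω) (hΩc : Convex ℝ Ω) (hΩne : Ω.Nonempty)
    {F : HAP Ω m} {ε : ℝ} {Λ : Finset (Fin n → ℝ)} {G : (Fin n → ℝ) → tube Ω → Fin m → ℂ}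
    (hG : IsApprox F Ω' ε Λ G) {V : Submodule ℚ (Fin n → ℝ)} {d : ℕ∞} {ω : ℕ → Fin n → ℝ}
    (hω : IsBasisSeq V d ω) (hΛ : ∀ lam ∈ Λ, lam ∈ V) {δ : ℝ} (hδ : 0 < δ) :
    ∀ᶠ j in atTop, ∀ z ∈ subtube Ω Ω', ∀ l,
      ‖(bochnerFejer d ω j F).toFun z l - F.toFun z l‖ ≤ 2 * ε + δ := by
  choose B hB using hG.bounded
  have hlim : Tendsto (fun j => ∑ lam ∈ Λ, |B lam| * |fejerWeight ω j (numTerms d j) lam - 1|)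
      atTop (𝓝 (∑ lam ∈ Λ, |B lam| * |(1 : ℝ) - 1|)) :=
    tendsto_finsetSum _ fun lam hlam =>
      (((tendsto_fejerWeight hω (hΛ lam hlam)).sub_const 1).abs).const_mul _
  simp only [sub_self, abs_zero, mul_zero, Finset.sum_const_zero] at hlim
  filter_upwards [hlim.eventually_lt_const hδ] with j hj z hz l
  -- One `ε` comes from the contraction, one from the approximation at `t = 0`, and `δ` from the
  -- weights, which are close to 1.
  have h1 := norm_fejer_sum_sub_le (hω.linearIndependent j) j (F.continuous_translate z l)
    (fun ν _ => hasCoeff_bohr hΩ hΩc hΩne F l (fejerFreq ω j ν) z)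
    (fun x => hG.approx z hz x l)
  have h2 := hG.approx z hz 0 l
  rw [translate_zero] at h2
  simp only [Pi.zero_apply, Complex.ofReal_zero, expo_zero, mul_one] at h2
  have h3 : ‖∑ lam ∈ Λ, G lam z l * (fejerWeight ω j (numTerms d j) lam : ℂ) -
      ∑ lam ∈ Λ, G lam z l‖ ≤ δ := by
    rw [← Finset.sum_sub_distrib]
    refine (norm_sum_le_of_le _ fun lam _ => ?_).trans hj.le
    rw [← mul_sub_one, norm_mul, ← Complex.ofReal_one, ← Complex.ofReal_sub, Complex.norm_real,
      Real.norm_eq_abs]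
    exact mul_le_mul_of_nonneg_right ((hB lam z hz l).trans (le_abs_self _)) (abs_nonneg _)
  simp only [← mul_assoc] at h1
  rw [← bochnerFejer_apply] at h1
  rw [norm_sub_rev] at h2
  have h4 := norm_add₃_le
    (a := (bochnerFejer d ω j F).toFun z l -
      ∑ lam ∈ Λ, G lam z l * (fejerWeight ω j (numTerms d j) lam : ℂ))
    (b := ∑ lam ∈ Λ, G lam z l * (fejerWeight ω j (numTerms d j) lam : ℂ) -
      ∑ lam ∈ Λ, G lam z l) (c := ∑ lam ∈ Λ, G lam z l - F.toFun z l)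
  rw [sub_add_sub_cancel, sub_add_sub_cancel] at h4
  linarith

lemma exists_bound_expo (hΩ' : RelCompact Ω' Ω) (lam : Fin n → ℝ) :
    ∃ B : ℝ, ∀ z ∈ subtube Ω Ω', ‖expo lam z.1‖ ≤ B := by
  have hcont : ContinuousOn (fun y : Fin n → ℝ => Real.exp (-∑ j, y j * lam j))
      (closure Ω') := by fun_prop
  obtain ⟨M, hM⟩ := hΩ'.1.exists_bound_of_continuousOn hcont
  refine ⟨M, fun z hz => ?_⟩
  rw [norm_expo]
  exact (le_abs_self _).trans (hM _ (subset_closure hz))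

/-- Approximation with frequencies in the frequency space. -/
lemma exists_isApprox_freqSpace (hΩ : IsOpen Ω) (hΩc : Convex ℝ Ω) (hΩne : Ω.Nonempty)
    (F : HAP Ω m) (hΩ' : RelCompact Ω' Ω) {ε : ℝ} (hε : 0 < ε) :
    ∃ Λ G, IsApprox F Ω' ε Λ G ∧ ∀ lam ∈ Λ, lam ∈ freqSpace F := by
  classical
  obtain ⟨Λ, G, hG, -⟩ := exists_isApprox F hΩ' (ε := ε / 3) (by positivity)
  -- The frequencies in `Λ` may have nothing to do with `F`. Bochner-Fejér sums for a basis of their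
  -- span still approximate `F`, and their coefficients vanish off the spectrum, so discarding the
  -- frequencies outside `freqSpace F` changes nothing.
  obtain ⟨d, η, hη⟩ := exists_isBasisSeq_span (Λ : Set (Fin n → ℝ)) Λ.countable_toSet
  obtain ⟨j, hj⟩ := (hG.eventually_bochnerFejer hΩ hΩc hΩne hη
    (fun lam hlam => Submodule.subset_span hlam) (δ := ε / 3) (by positivity)).exists
  refine ⟨((fejerBox j (numTerms d j)).image fun ν => fejerFreq η j ν).filter (· ∈ freqSpace F),
    fun lam z l => fejerWeight η j (numTerms d j) lam * bohr F l lam * expo lam z.1,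
    ⟨fun lam => ?_, fun z hz t l => ?_⟩, fun lam hlam => (Finset.mem_filter.1 hlam).2⟩
  · obtain ⟨B, hB⟩ := exists_bound_expo hΩ' lam
    refine ⟨∑ l, ‖(fejerWeight η j (numTerms d j) lam : ℂ) * bohr F l lam‖ * |B|,
      fun z hz l => ?_⟩
    rw [norm_mul]
    refine (mul_le_mul_of_nonneg_left ((hB z hz).trans (le_abs_self _)) (norm_nonneg _)).trans ?_
    exact Finset.single_le_sum (f := fun l =>
      ‖(fejerWeight η j (numTerms d j) lam : ℂ) * bohr F l lam‖ * |B|)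
      (fun _ _ => by positivity) (Finset.mem_univ l)
  · have h1 := hj _ (translate_mem_subtube hz t) l
    rw [norm_sub_rev] at h1
    have h2 : (bochnerFejer d η j F).toFun (translate z t) l =
        ∑ lam ∈ ((fejerBox j (numTerms d j)).image fun ν => fejerFreq η j ν).filter
          (· ∈ freqSpace F),
          fejerWeight η j (numTerms d j) lam * bohr F l lam * expo lam z.1 *
            expo lam fun i => (t i : ℂ) := by
      rw [Finset.sum_filter_of_ne, bochnerFejer_apply,
        Finset.sum_image fun ν _ ν' _ h => fejerFreq_injective (hη.linearIndependent j) j h]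
      · refine Finset.sum_congr rfl fun ν hν => ?_
        have h3 : fejerWeight η j (numTerms d j) (fejerFreq η j ν) = fejerMult j ν := by
          rw [fejerWeight, Finset.sum_eq_single_of_mem ν hν, if_pos rfl]
          intro ν' _ hne
          rw [if_neg]
          exact fun h => hne (fejerFreq_injective (hη.linearIndependent j) j h.symm)
        rw [h3, expo_translate, mul_assoc (_ * _)]
      · intro lam _ hne
        refine mem_freqSpace (l := l) fun h0 => hne ?_
        rw [h0]; simp
    rw [← h2]
    linarith

/-- The Bochner-Fejér approximations converge. -/
theorem eventually_bochnerFejer (hΩ : IsOpen Ω) (hΩc : Convex ℝ Ω) (hΩne : Ω.Nonempty)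
    {F : HAP Ω m} (hΩ' : RelCompact Ω' Ω) {d : ℕ∞} {ω : ℕ → Fin n → ℝ}
    (hω : IsBasisSeq (freqSpace F) d ω) {ε : ℝ} (hε : 0 < ε) :
    ∀ᶠ j in atTop, ∀ z ∈ subtube Ω Ω', ∀ l,
      ‖(bochnerFejer d ω j F).toFun z l - F.toFun z l‖ ≤ ε := by
  obtain ⟨Λ, G, hG, hΛ⟩ := exists_isApprox_freqSpace hΩ hΩc hΩne F hΩ' (ε := ε / 4) (by positivity)
  filter_upwards [hG.eventually_bochnerFejer hΩ hΩc hΩne hω hΛ (half_pos hε)] with j hj z hz l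
  refine (hj z hz l).trans (le_of_eq (by ring))

/-! ### Exponential sums at discontinuous characters -/

/-- The coefficients are means of the values at continuous characters. -/
lemma norm_coeff_le {p : AddMonoidAlgebra ℂ (Fin n → ℝ)} {M : ℝ}
    (hM : ∀ t, ‖evalCh (realChar t) p‖ ≤ M) (lam : Fin n → ℝ) : ‖p.coeff lam‖ ≤ M := by
  classical
  have h := hasCoeff_expSum p.coeff.support (fun mu => p.coeff mu) (fun mu => mu) lam
  have h1 : (∑ mu ∈ p.coeff.support, if mu = lam then p.coeff mu else 0) = p.coeff lam := by
    rw [Finset.sum_ite_eq']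
    split_ifs with h2
    · rfl
    · exact (Finsupp.notMem_support_iff.1 h2).symm
  rw [h1] at h
  refine h.norm_le fun t => ?_
  have h3 := hM t
  rw [evalCh_apply] at h3
  simpa only [coe_realChar] using h3

/-- A frequency of `p ^ k` is a combination of those of `p` with multiplicities between 0 and `k`.
What matters is that the bound is polynomial in `k`. -/
lemma card_support_pow_le (p : AddMonoidAlgebra ℂ (Fin n → ℝ)) (k : ℕ) :
    (p ^ k).coeff.support.card ≤ (k + 1) ^ p.coeff.support.card := by
  classical
  have hsupp : ∀ k, ∀ lam ∈ (p ^ k).coeff.support, ∃ α : p.coeff.support → ℕ,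
      (∀ i, α i < k + 1) ∧ ∑ i, α i • (i : Fin n → ℝ) = lam := by
    intro k
    induction k with
    | zero =>
      intro lam hlam
      refine ⟨0, by simp, ?_⟩
      rw [pow_zero, AddMonoidAlgebra.one_def] at hlam
      have := Finsupp.support_single_subset hlam
      simpa [eq_comm] using this
    | succ k ih =>
      intro lam hlam
      rw [pow_succ] at hlam
      obtain ⟨mu, hmu, i, hi, rfl⟩ :=
        Finset.mem_add.1 (AddMonoidAlgebra.support_coeff_mul_subset _ _ hlam)
      obtain ⟨α, hα, rfl⟩ := ih mu hmu
      refine ⟨α + Pi.single ⟨i, hi⟩ 1, fun i' => ?_, ?_⟩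
      · have h1 := hα i'
        have h2 : (Pi.single ⟨i, hi⟩ 1 : p.coeff.support → ℕ) i' ≤ 1 := by
          rw [Pi.single_apply]; split_ifs <;> simp
        rw [Pi.add_apply]
        omega
      · simp only [Pi.add_apply, add_smul, Finset.sum_add_distrib]
        congr 1
        rw [Finset.sum_eq_single ⟨i, hi⟩]
        · simp
        · intro b _ hb
          rw [Pi.single_eq_of_ne hb, zero_smul]
        · simp
  have hsub : (p ^ k).coeff.support ⊆
      (Fintype.piFinset fun _ : p.coeff.support => Finset.range (k + 1)).image
        fun α : p.coeff.support → ℕ => ∑ i, α i • (i : Fin n → ℝ) := by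
    intro lam hlam
    obtain ⟨α, hα, rfl⟩ := hsupp k lam hlam
    exact Finset.mem_image.2 ⟨α, Fintype.mem_piFinset.2 fun i => Finset.mem_range.2 (hα i), rfl⟩
  refine (Finset.card_le_card hsub).trans (Finset.card_image_le.trans ?_)
  simp

/-- The values of an exponential sum at arbitrary characters are bounded by the supremum over the
continuous characters. -/
theorem norm_evalCh_le {p : AddMonoidAlgebra ℂ (Fin n → ℝ)} {M : ℝ}
    (hM : ∀ t, ‖evalCh (realChar t) p‖ ≤ M) (χ : Ch n) : ‖evalCh χ p‖ ≤ M := by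
  have hM0 : 0 ≤ M := (norm_nonneg _).trans (hM 0)
  -- The power trick: the crude bound by the sum of the coefficients, applied to `p ^ k`, loses only
  -- a polynomial factor, which cannot keep up with `r ^ k` for `r > 1`.
  have hpow : ∀ k : ℕ, ‖evalCh χ p‖ ^ k ≤ ((k : ℝ) + 1) ^ p.coeff.support.card * M ^ k := by
    intro k
    rw [← norm_pow, ← map_pow, evalCh_apply]
    have h1 : ∀ lam, ‖(p ^ k).coeff lam‖ ≤ M ^ k := norm_coeff_le fun t => by
      rw [map_pow, norm_pow]
      exact pow_le_pow_left₀ (norm_nonneg _) (hM t) k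
    calc _ ≤ ∑ lam ∈ (p ^ k).coeff.support, M ^ k := norm_sum_le_of_le _ fun lam _ => by
            rw [norm_mul, Circle.norm_coe, mul_one]; exact h1 lam
      _ = ((p ^ k).coeff.support.card : ℝ) * M ^ k := by rw [Finset.sum_const, nsmul_eq_mul]
      _ ≤ _ := by
          refine mul_le_mul_of_nonneg_right ?_ (by positivity)
          exact_mod_cast card_support_pow_le p k
  by_contra! hlt
  obtain ⟨M', hM', hlt'⟩ := exists_between hlt
  have hM'0 : 0 < M' := hM0.trans_lt hM'
  set r := ‖evalCh χ p‖ / M' with hr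
  have hr1 : 1 < r := (one_lt_div hM'0).2 hlt'
  have hr0 : 0 < r := one_pos.trans hr1
  have hrk : ∀ k : ℕ, r ^ k ≤ ((k : ℝ) + 1) ^ p.coeff.support.card := by
    intro k
    rw [hr, div_pow, div_le_iff₀ (by positivity)]
    refine (hpow k).trans (mul_le_mul_of_nonneg_left ?_ (by positivity))
    exact pow_le_pow_left₀ hM0 hM'.le k
  have hlim := (tendsto_pow_const_div_const_pow_of_one_lt p.coeff.support.card hr1).comp
    (tendsto_add_atTop_nat 1)
  have hge : ∀ k : ℕ, 1 / r ≤ ((k + 1 : ℕ) : ℝ) ^ p.coeff.support.card / r ^ (k + 1) := by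
    intro k
    rw [div_le_div_iff₀ hr0 (by positivity), one_mul, pow_succ]
    have := hrk k
    push_cast
    exact mul_le_mul_of_nonneg_right this hr0.le
  have := ge_of_tendsto' hlim hge
  have : 0 < 1 / r := by positivity
  linarith

/-! ### Perturbation of exponential sums -/

lemma bohr_expSum (hΩ : IsOpen Ω) (hΩc : Convex ℝ Ω) (hΩne : Ω.Nonempty)
    {ι : Type*} (s : Finset ι) (c : ι → Fin m → ℂ) (μ : ι → Fin n → ℝ) (l : Fin m)
    (lam : Fin n → ℝ) [DecidableEq (Fin n → ℝ)] :
    bohr (expSum Ω s c μ) l lam = ∑ i ∈ s, if μ i = lam then c i l else 0 := by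
  obtain ⟨y, hy⟩ := hΩne
  let z : tube Ω := tubePoint 0 ⟨y, hy⟩
  have h1 := hasCoeff_bohr hΩ hΩc ⟨y, hy⟩ (expSum Ω s c μ) l lam z
  have h2 := hasCoeff_expSum s (fun i => c i l * expo (μ i) z.1) μ lam
  have h3 : (fun t => (expSum Ω s c μ).toFun (translate z t) l) =
      fun x => ∑ i ∈ s, c i l * expo (μ i) z.1 * expo (μ i) fun j => (x j : ℂ) := by
    funext x
    show ∑ i ∈ s, c i l * expo (μ i) (translate z x).1 = _
    simp only [expo_translate, mul_assoc]
  rw [h3] at h1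
  have h4 := h1.unique h2
  refine mul_right_cancel₀ (expo_ne_zero lam z.1) (h4.trans ?_)
  rw [Finset.sum_mul]
  refine Finset.sum_congr rfl fun i _ => ?_
  rw [ite_mul, zero_mul]
  split_ifs with h
  · rw [h]
  · rfl

/-- The perturbation of an exponential sum, in terms of any representation of the sum. -/
lemma perturbExp_expSum (hΩ : IsOpen Ω) (hΩc : Convex ℝ Ω) (hΩne : Ω.Nonempty)
    {ι : Type*} (s : Finset ι) (c : ι → Fin m → ℂ) (μ : ι → Fin n → ℝ) (χ : Ch n)
    (z : tube Ω) (l : Fin m) :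
    (perturbExp χ (expSum Ω s c μ)).toFun z l =
      ∑ i ∈ s, c i l * expo (μ i) z.1 * (χ (μ i) : ℂ) := by
  classical
  have hsub : (⋃ l, spec (expSum Ω s c μ) l) ⊆ (s.image μ : Finset (Fin n → ℝ)) := by
    refine Set.iUnion_subset fun l lam hlam => ?_
    by_contra hcon
    refine hlam ?_
    rw [bohr_expSum hΩ hΩc hΩne]
    refine Finset.sum_eq_zero fun i hi => if_neg fun h => hcon ?_
    exact Finset.mem_coe.2 (Finset.mem_image.2 ⟨i, hi, h⟩)
  have hfin : (⋃ l, spec (expSum Ω s c μ) l).Finite := (Finset.finite_toSet _).subset hsub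
  rw [perturbExp, dif_pos hfin]
  show ∑ lam ∈ hfin.toFinset, bohr (expSum Ω s c μ) l lam * (χ lam : ℂ) * expo lam z.1 = _
  rw [Finset.sum_subset (s₂ := s.image μ)]
  · simp only [bohr_expSum hΩ hΩc hΩne, Finset.sum_mul, ite_mul, zero_mul]
    rw [Finset.sum_comm]
    refine Finset.sum_congr rfl fun i hi => ?_
    rw [Finset.sum_ite_eq, if_pos (Finset.mem_image_of_mem μ hi)]
    ring
  · intro lam hlam
    exact hsub (hfin.mem_toFinset.1 hlam)
  · intro lam _ hlam
    have : bohr (expSum Ω s c μ) l lam = 0 := by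
      by_contra h
      exact hlam (hfin.mem_toFinset.2 (Set.mem_iUnion.2 ⟨l, h⟩))
    rw [this, zero_mul, zero_mul]

/-- Perturbation of exponential sums is a contraction. -/
lemma norm_perturbExp_sub_le (hΩ : IsOpen Ω) (hΩc : Convex ℝ Ω) (hΩne : Ω.Nonempty)
    {ι ι' : Type*} (s : Finset ι) (c : ι → Fin m → ℂ) (μ : ι → Fin n → ℝ)
    (s' : Finset ι') (c' : ι' → Fin m → ℂ) (μ' : ι' → Fin n → ℝ) (χ : Ch n)
    (z : tube Ω) (l : Fin m) {M : ℝ}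
    (hM : ∀ t, ‖(expSum Ω s c μ).toFun (translate z t) l -
      (expSum Ω s' c' μ').toFun (translate z t) l‖ ≤ M) :
    ‖(perturbExp χ (expSum Ω s c μ)).toFun z l -
      (perturbExp χ (expSum Ω s' c' μ')).toFun z l‖ ≤ M := by
  rw [perturbExp_expSum hΩ hΩc hΩne, perturbExp_expSum hΩ hΩc hΩne]
  -- With `e^{i⟨z, μ⟩}` absorbed into the coefficients, `realChar t` evaluates the difference at `z
  -- + t`, and `χ` evaluates the perturbed difference at `z`.
  set p : AddMonoidAlgebra ℂ (Fin n → ℝ) :=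
    ∑ i ∈ s, AddMonoidAlgebra.single (μ i) (c i l * expo (μ i) z.1) -
      ∑ i ∈ s', AddMonoidAlgebra.single (μ' i) (c' i l * expo (μ' i) z.1) with hp
  have heval : ∀ χ : Ch n, evalCh χ p = ∑ i ∈ s, c i l * expo (μ i) z.1 * (χ (μ i) : ℂ) -
      ∑ i ∈ s', c' i l * expo (μ' i) z.1 * (χ (μ' i) : ℂ) := by
    intro χ
    rw [hp, map_sub, map_sum, map_sum]
    simp only [evalCh_single]
  rw [← heval]
  refine norm_evalCh_le (fun t => ?_) χ
  have h1 := hM t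
  rw [heval]
  simp only [coe_realChar, mul_assoc, ← expo_translate]
  exact h1

/-! ### The topology of `HAP` and its completeness -/

lemma tendsto_hap_iff {α : Type*} {p : Filter α} {G : α → HAP Ω m} {F : HAP Ω m} :
    Tendsto G p (𝓝 F) ↔ ∀ Ω', RelCompact Ω' Ω → ∀ ε : ℝ, 0 < ε → ∀ᶠ i in p,
      ∀ z ∈ subtube Ω Ω', ∀ l, ‖(G i).toFun z l - F.toFun z l‖ ≤ ε := by
  have hind : IsInducing (fun F : HAP Ω m =>
    UniformOnFun.ofFun {S | ∃ Ω', RelCompact Ω' Ω ∧ S = subtube Ω Ω'} F.toFun) := ⟨rfl⟩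
  rw [hind.tendsto_nhds_iff, UniformOnFun.tendsto_iff_tendstoUniformlyOn]
  constructor
  · intro h Ω' hΩ' ε hε
    have h1 := Metric.tendstoUniformlyOn_iff.1 (h _ ⟨Ω', hΩ', rfl⟩) ε hε
    filter_upwards [h1] with i hi z hz l
    rw [norm_sub_rev, ← dist_eq_norm]
    exact (dist_le_pi_dist _ _ l).trans (hi z hz).le
  · rintro h _ ⟨Ω', hΩ', rfl⟩
    rw [Metric.tendstoUniformlyOn_iff]
    intro ε hε
    filter_upwards [h Ω' hΩ' (ε / 2) (half_pos hε)] with i hi z hz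
    refine lt_of_le_of_lt ((dist_pi_le_iff (half_pos hε).le).2 fun l => ?_) (half_lt_self hε)
    rw [dist_comm, dist_eq_norm]
    exact hi z hz l

/-- Subtubes over single points cover the tube. The Hausdorff property identifies the perturbation
of an exponential sum by uniqueness of limits. -/
instance : T2Space (HAP Ω m) := by
  have hinj : Function.Injective (fun F : HAP Ω m =>
      UniformOnFun.ofFun {S | ∃ Ω', RelCompact Ω' Ω ∧ S = subtube Ω Ω'} F.toFun) :=
    fun F G h => HAP.ext_toFun fun z l =>
      congrFun (congrFun ((UniformOnFun.ofFun _).injective h) z) l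
  have : T2Space (UniformOnFun (tube Ω) (Fin m → ℂ)
      {S | ∃ Ω', RelCompact Ω' Ω ∧ S = subtube Ω Ω'}) := by
    refine UniformOnFun.t2Space_of_covering (Set.eq_univ_of_forall fun z => ?_)
    exact ⟨_, ⟨_, relCompact_singleton ⟨_, z.2⟩, rfl⟩, subtube_singleton z⟩
  exact (IsEmbedding.mk ⟨rfl⟩ hinj).t2Space

/-- Completeness of the space of holomorphic almost periodic mappings. -/
theorem exists_tendsto_hap (hΩ : IsOpen Ω) {G : ℕ → HAP Ω m}
    (hG : ∀ Ω', RelCompact Ω' Ω → ∀ ε : ℝ, 0 < ε → ∃ J, ∀ j ≥ J, ∀ k ≥ J,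
      ∀ z ∈ subtube Ω Ω', ∀ l, ‖(G j).toFun z l - (G k).toFun z l‖ ≤ ε) :
    ∃ F : HAP Ω m, Tendsto G atTop (𝓝 F) := by
  have hlim : ∀ z l, ∃ w, Tendsto (fun j => (G j).toFun z l) atTop (𝓝 w) := by
    intro z l
    refine cauchySeq_tendsto_of_complete (Metric.cauchySeq_iff.2 fun ε hε => ?_)
    obtain ⟨J, hJ⟩ := hG _ (relCompact_singleton ⟨_, z.2⟩) (ε / 2) (half_pos hε)
    refine ⟨J, fun j hj k hk => ?_⟩
    rw [dist_eq_norm]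
    exact (hJ j hj k hk z (subtube_singleton z) l).trans_lt (half_lt_self hε)
  choose f hf using hlim
  have hunif : ∀ Ω', RelCompact Ω' Ω → ∀ ε : ℝ, 0 < ε → ∃ J, ∀ j ≥ J,
      ∀ z ∈ subtube Ω Ω', ∀ l, ‖(G j).toFun z l - f z l‖ ≤ ε := by
    intro Ω' hΩ' ε hε
    obtain ⟨J, hJ⟩ := hG Ω' hΩ' ε hε
    refine ⟨J, fun j hj z hz l => ?_⟩
    refine le_of_tendsto ((tendsto_const_nhds.sub (hf z l)).norm) ?_
    filter_upwards [eventually_ge_atTop J] with k hk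
    exact hJ j hj k hk z hz l
  refine ⟨⟨f, ?_, ?_⟩, tendsto_hap_iff.2 fun Ω' hΩ' ε hε => ?_⟩
  · refine isHolomorphic_of_approx hΩ fun Ω' hΩ' ε hε => ?_
    obtain ⟨J, hJ⟩ := hunif Ω' hΩ' ε hε
    exact ⟨(G J).toFun, (G J).holomorphic, hJ J le_rfl⟩
  · intro ε hε Ω' hΩ'
    obtain ⟨J, hJ⟩ := hunif Ω' hΩ' (ε / 3) (by positivity)
    obtain ⟨t, ht, h⟩ := (G J).almostPeriodic (ε / 3) (by positivity) Ω' hΩ'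
    refine ⟨t, ht, fun ξ => ?_⟩
    obtain ⟨τ, hτ, hτ'⟩ := h ξ
    refine ⟨τ, hτ, fun z hz l => ?_⟩
    have h1 := hJ J le_rfl z hz l
    have h2 := hJ J le_rfl _ (translate_mem_subtube hz τ) l
    have h3 := hτ' z hz l
    rw [norm_sub_rev] at h2
    have h4 := norm_add₃_le (a := f (translate z τ) l - (G J).toFun (translate z τ) l)
      (b := (G J).toFun (translate z τ) l - (G J).toFun z l) (c := (G J).toFun z l - f z l)
    rw [sub_add_sub_cancel, sub_add_sub_cancel] at h4
    linarith
  · obtain ⟨J, hJ⟩ := hunif Ω' hΩ' ε hε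
    filter_upwards [eventually_ge_atTop J] with j hj
    exact hJ j hj

/-! ### Existence, independence of the basis and continuity of the perturbation -/

/-- The perturbed Bochner-Fejér approximations for any two bases approach each other, uniformly in
the character. -/
lemma exists_perturbExp_bochnerFejer_close (hΩ : IsOpen Ω) (hΩc : Convex ℝ Ω) (hΩne : Ω.Nonempty)
    (F : HAP Ω m) (hΩ' : RelCompact Ω' Ω) {d d' : ℕ∞} {ω ω' : ℕ → Fin n → ℝ}
    (hω : IsBasisSeq (freqSpace F) d ω) (hω' : IsBasisSeq (freqSpace F) d' ω') {ε : ℝ}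
    (hε : 0 < ε) :
    ∃ J, ∀ j ≥ J, ∀ k ≥ J, ∀ χ : Ch n, ∀ z ∈ subtube Ω Ω', ∀ l,
      ‖(perturbExp χ (bochnerFejer d ω j F)).toFun z l -
        (perturbExp χ (bochnerFejer d' ω' k F)).toFun z l‖ ≤ ε := by
  obtain ⟨J, hJ⟩ := eventually_atTop.1
    ((eventually_bochnerFejer hΩ hΩc hΩne hΩ' hω (half_pos hε)).and
      (eventually_bochnerFejer hΩ hΩc hΩne hΩ' hω' (half_pos hε)))
  refine ⟨J, fun j hj k hk χ z hz l => ?_⟩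
  -- All translates of `z` stay in the subtube, so the unperturbed estimate supplies the hypothesis
  -- of the contraction, with a `J` that does not depend on `χ`.
  refine norm_perturbExp_sub_le hΩ hΩc hΩne _ _ _ _ _ _ χ z l fun t => ?_
  have h1 := (hJ j hj).1 _ (translate_mem_subtube hz t) l
  have h2 := (hJ k hk).2 _ (translate_mem_subtube hz t) l
  rw [norm_sub_rev] at h2
  have h3 := norm_sub_le_norm_sub_add_norm_sub
    ((bochnerFejer d ω j F).toFun (translate z t) l) (F.toFun (translate z t) l)
    ((bochnerFejer d' ω' k F).toFun (translate z t) l)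
  exact h3.trans (by linarith)

/-- The perturbed Bochner-Fejér approximations converge, uniformly in the character. -/
lemma exists_perturb_close (hΩ : IsOpen Ω) (hΩc : Convex ℝ Ω) (hΩne : Ω.Nonempty)
    (F : HAP Ω m) (hΩ' : RelCompact Ω' Ω) {d : ℕ∞} {ω : ℕ → Fin n → ℝ}
    (hω : IsBasisSeq (freqSpace F) d ω) {ε : ℝ} (hε : 0 < ε) :
    ∃ J, ∀ j ≥ J, ∀ χ : Ch n, ∀ z ∈ subtube Ω Ω', ∀ l,
      ‖(perturbExp χ (bochnerFejer d ω j F)).toFun z l - (perturb χ F).toFun z l‖ ≤ ε := by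
  have hperturb : ∀ χ : Ch n, ∃ (d : ℕ∞) (ω : ℕ → Fin n → ℝ), IsBasisSeq (freqSpace F) d ω ∧
      Tendsto (fun j => perturbExp χ (bochnerFejer d ω j F)) atTop (𝓝 (perturb χ F)) := by
    intro χ
    obtain ⟨G, hG⟩ := exists_tendsto_hap hΩ
      (G := fun j => perturbExp χ (bochnerFejer d ω j F)) fun Ω' hΩ' ε hε => by
        obtain ⟨J, hJ⟩ := exists_perturbExp_bochnerFejer_close hΩ hΩc hΩne F hΩ' hω hω hε
        exact ⟨J, fun j hj k hk => hJ j hj k hk χ⟩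
    exact Classical.epsilon_spec (p := fun G : HAP Ω m => ∃ (d : ℕ∞) (ω : ℕ → Fin n → ℝ),
      IsBasisSeq (freqSpace F) d ω ∧
        Tendsto (fun j => perturbExp χ (bochnerFejer d ω j F)) atTop (𝓝 G)) ⟨G, d, ω, hω, hG⟩
  obtain ⟨J₀, hJ₀⟩ := exists_perturbExp_bochnerFejer_close hΩ hΩc hΩne F hΩ' hω hω
    (ε := ε / 3) (by positivity)
  refine ⟨J₀, fun j hj χ z hz l => ?_⟩
  -- The basis behind `perturb` may depend on `χ`, and `J₁` with it; this is harmless, because only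
  -- one large index `k` is needed for the comparison, while `J₀` is uniform.
  obtain ⟨d', ω', hω', hlim⟩ := hperturb χ
  obtain ⟨J₁, hJ₁⟩ := exists_perturbExp_bochnerFejer_close hΩ hΩc hΩne F hΩ' hω hω'
    (ε := ε / 3) (by positivity)
  obtain ⟨k, hk, hk₀, hk₁⟩ := ((tendsto_hap_iff.1 hlim Ω' hΩ' (ε / 3) (by positivity)).and
    ((eventually_ge_atTop J₀).and (eventually_ge_atTop J₁))).exists
  have h1 := hJ₀ j hj k hk₀ χ z hz l
  have h2 := hJ₁ k hk₁ k hk₁ χ z hz l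
  have h3 := hk z hz l
  have h4 := norm_add₃_le
    (a := (perturbExp χ (bochnerFejer d ω j F)).toFun z l -
      (perturbExp χ (bochnerFejer d ω k F)).toFun z l)
    (b := (perturbExp χ (bochnerFejer d ω k F)).toFun z l -
      (perturbExp χ (bochnerFejer d' ω' k F)).toFun z l)
    (c := (perturbExp χ (bochnerFejer d' ω' k F)).toFun z l - (perturb χ F).toFun z l)
  rw [sub_add_sub_cancel, sub_add_sub_cancel] at h4
  linarith

theorem tendsto_perturb (hΩ : IsOpen Ω) (hΩc : Convex ℝ Ω) (hΩne : Ω.Nonempty)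
    (F : HAP Ω m) {d : ℕ∞} {ω : ℕ → Fin n → ℝ} (hω : IsBasisSeq (freqSpace F) d ω) (χ : Ch n) :
    Tendsto (fun j => perturbExp χ (bochnerFejer d ω j F)) atTop (𝓝 (perturb χ F)) := by
  refine tendsto_hap_iff.2 fun Ω' hΩ' ε hε => ?_
  obtain ⟨J, hJ⟩ := exists_perturb_close hΩ hΩc hΩne F hΩ' hω hε
  filter_upwards [eventually_ge_atTop J] with j hj
  exact hJ j hj χ

/-- Since `Q_j(F) → F` and perturbation of exponential sums is a contraction, `Q_j(F)_χ` also
converges to `perturbExp χ F`. -/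
theorem perturb_eq_perturbExp (hΩ : IsOpen Ω) (hΩc : Convex ℝ Ω) (hΩne : Ω.Nonempty)
    {F : HAP Ω m} (hF : IsExp F) (χ : Ch n) : perturb χ F = perturbExp χ F := by
  obtain ⟨d, ω, hω⟩ := exists_isBasisSeq hΩ hΩc hΩne F
  refine tendsto_nhds_unique (tendsto_perturb hΩ hΩc hΩne F hω χ)
    (tendsto_hap_iff.2 fun Ω' hΩ' ε hε => ?_)
  obtain ⟨s, c, hsc⟩ := hF
  have hF' : F = expSum Ω s c fun lam => lam := HAP.ext_toFun hsc
  filter_upwards [eventually_bochnerFejer hΩ hΩc hΩne hΩ' hω hε] with j hj z hz l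
  have h1 := fun t => hj _ (translate_mem_subtube hz t) l
  -- Hiding the Bochner-Fejér sum lets `F` be rewritten as an explicit sum outside it only.
  generalize hQ : bochnerFejer d ω j F = Q at h1 ⊢
  unfold bochnerFejer at hQ
  subst hQ
  rw [hF'] at h1 ⊢
  exact norm_perturbExp_sub_le hΩ hΩc hΩne _ _ _ _ _ _ χ z l h1

/-- A limit, uniform in `χ`, of maps that depend on `χ` through finitely many values only: the usual
`ε / 3` argument on each subtube. -/
theorem continuous_perturb (hΩ : IsOpen Ω) (hΩc : Convex ℝ Ω) (hΩne : Ω.Nonempty)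
    (F : HAP Ω m) : Continuous fun χ : Ch n => perturb χ F := by
  obtain ⟨d, ω, hω⟩ := exists_isBasisSeq hΩ hΩc hΩne F
  refine continuous_iff_continuousAt.2 fun χ₀ => tendsto_hap_iff.2 fun Ω' hΩ' ε hε => ?_
  obtain ⟨j, hj⟩ := exists_perturb_close hΩ hΩc hΩne F hΩ' hω (ε := ε / 3) (by positivity)
  replace hj := hj j le_rfl
  choose B hB using fun lam : Fin n → ℝ => exists_bound_expo hΩ' lam
  set I := fejerBox j (numTerms d j)
  set C : (Fin (numTerms d j) → ℤ) → Fin m → ℂ := fun ν l =>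
    (fejerMult j ν : ℂ) * bohr F l (fejerFreq ω j ν) with hC
  -- A continuous majorant, vanishing at `χ₀`, of the change of the perturbed sum over the whole
  -- subtube.
  set g : Ch n → ℝ := fun χ => ∑ l, ∑ ν ∈ I, ‖C ν l‖ * |B (fejerFreq ω j ν)| *
    ‖(χ (fejerFreq ω j ν) : ℂ) - χ₀ (fejerFreq ω j ν)‖ with hg
  have hgc : Continuous g :=
    continuous_finsetSum _ fun l _ => continuous_finsetSum _ fun ν _ =>
      continuous_const.mul ((continuous_coe_ch _).sub continuous_const).norm
  have hg0 : g χ₀ = 0 := by simp [hg]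
  have hev : ∀ᶠ χ in 𝓝 χ₀, g χ < ε / 3 :=
    hgc.continuousAt.eventually_lt_const (by rw [hg0]; positivity)
  filter_upwards [hev] with χ hχ z hz l
  have hval : ∀ χ : Ch n, (perturbExp χ (bochnerFejer d ω j F)).toFun z l =
      ∑ ν ∈ I, C ν l * expo (fejerFreq ω j ν) z.1 * (χ (fejerFreq ω j ν) : ℂ) :=
    fun χ => perturbExp_expSum hΩ hΩc hΩne _ _ _ χ z l
  have h1 : ‖(perturbExp χ (bochnerFejer d ω j F)).toFun z l -
      (perturbExp χ₀ (bochnerFejer d ω j F)).toFun z l‖ ≤ g χ := by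
    rw [hval, hval, ← Finset.sum_sub_distrib]
    refine (norm_sum_le_of_le _ fun ν _ => ?_).trans (Finset.single_le_sum
      (f := fun l => ∑ ν ∈ I, ‖C ν l‖ * |B (fejerFreq ω j ν)| *
        ‖(χ (fejerFreq ω j ν) : ℂ) - χ₀ (fejerFreq ω j ν)‖)
      (fun _ _ => by positivity) (Finset.mem_univ l))
    rw [← mul_sub, norm_mul, norm_mul]
    gcongr
    exact (hB _ z hz).trans (le_abs_self _)
  have h2 := hj χ z hz l
  have h3 := hj χ₀ z hz l
  rw [norm_sub_rev] at h2
  have h4 := norm_add₃_le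
    (a := (perturb χ F).toFun z l - (perturbExp χ (bochnerFejer d ω j F)).toFun z l)
    (b := (perturbExp χ (bochnerFejer d ω j F)).toFun z l -
      (perturbExp χ₀ (bochnerFejer d ω j F)).toFun z l)
    (c := (perturbExp χ₀ (bochnerFejer d ω j F)).toFun z l - (perturb χ₀ F).toFun z l)
  rw [sub_add_sub_cancel, sub_add_sub_cancel] at h4
  linarith

end AlmostPeriodic

end

theorem corollary3p2 {n m : ℕ} (Ω : Set (Fin n → ℝ)) (hΩ_nonempty : Ω.Nonempty)
    (hΩ_open : IsOpen Ω) (hΩ_convex : Convex ℝ Ω) (F : AlmostPeriodic.HAP Ω m) :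
    -- the perturbed mappings are well defined, for any basis of the frequency space
    (∃ (d : ℕ∞) (ω : ℕ → Fin n → ℝ),
      AlmostPeriodic.IsBasisSeq (AlmostPeriodic.freqSpace F) d ω) ∧
    (∀ (d : ℕ∞) (ω : ℕ → Fin n → ℝ),
      AlmostPeriodic.IsBasisSeq (AlmostPeriodic.freqSpace F) d ω →
      ∀ χ : AlmostPeriodic.Ch n,
        Tendsto
          (fun j => AlmostPeriodic.perturbExp χ (AlmostPeriodic.bochnerFejer d ω j F)) atTop
          (𝓝 (AlmostPeriodic.perturb χ F))) ∧
    -- they extend the perturbation of exponential sums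
    (AlmostPeriodic.IsExp F →
      ∀ χ : AlmostPeriodic.Ch n,
        AlmostPeriodic.perturb χ F = AlmostPeriodic.perturbExp χ F) ∧
    -- the character group is compact, and perturbation is continuous in the character
    CompactSpace (AlmostPeriodic.Ch n) ∧
    Continuous (fun χ : AlmostPeriodic.Ch n => AlmostPeriodic.perturb χ F) :=
  ⟨AlmostPeriodic.exists_isBasisSeq hΩ_open hΩ_convex hΩ_nonempty F,
    fun _ _ hω χ => AlmostPeriodic.tendsto_perturb hΩ_open hΩ_convex hΩ_nonempty F hω χ,
    fun hF χ => AlmostPeriodic.perturb_eq_perturbExp hΩ_open hΩ_convex hΩ_nonempty hF χ,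
    inferInstance,
    AlmostPeriodic.continuous_perturb hΩ_open hΩ_convex hΩ_nonempty F⟩
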